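/- Let $s\in\mathbb C\setminus\{0\}$ and let $(\alpha,s)$ satisfy one of: $0<\alpha\le 1$ and $\arg s\in\{(1-\frac\alpha2)\pi,\pi\}$; or $1<\alpha\le 2$ and $\arg s=(1-\frac\alpha2)\pi$. We call $\arg s=\pi$ the positive case and $\arg s=(1-\frac\alpha2)\pi$ the symmetric case. **Powers.** The powers $z^\alpha$, $z^{\alpha-1}$ and $z^{1/\alpha}$ of a complex number $z\ne0$ are taken with $\arg z\in[0,2\pi)$, while $z^{1/2}$ is the principal power. **Measures.** Write $G_\mu(z)=\int_{\mathbb R}\frac{\mu(dx)}{z-x}$. Let $a^\alpha_s$ be the monotone $\alpha$-stable law, that is, the probability measure on $\mathbb R$ with $1/G_{a^\alpha_s}(z)=(z^\alpha+(-1)^{\alpha-1}s)^{1/\alpha}$ for $\operatorname{Im}z>0$. Let $\mu^\alpha_{s,2}$ be the probability measure on $\mathbb R$ with $$G_{\mu^\alpha_{s,2}}(z)=-2^{1/\alpha}\Big(\frac{1-(1-s(-1/z)^\alpha)^{1/2}}{s}\Big)^{1/\alpha},\qquad \operatorname{Im}z>0.$$ Let $m$ be the Marchenko–Pastur law, with density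 $\frac{\sqrt{x(4-x)}}{2\pi x}$ on $(0,4)$. **S-transform.** Let $\psi_\mu(z)=\int_{\mathbb R}\frac{zx}{1-zx}\,\mu(dx)$ and $S_\mu(z)=\frac{1+z}{z}\chi_\mu(z)$, where $\chi_\mu:\psi_\mu(D)\to D$ is the inverse of $\psi_\mu$ on a domain $D$. For measures on $[0,\infty)$ (that is, for $m$ always, and for $a^\alpha_s$, $a^\alpha_{s/4}$ and $\mu^\alpha_{s,2}$ in the positive case) take $D=\{\operatorname{Re}w<0\}$. For $a^\alpha_s$, $a^\alpha_{s/4}$ and $\mu^\alpha_{s,2}$ in the symmetric case there are two choices of $D$, namely $\{\operatorname{Im}w>|\operatorname{Re}w|\}$ and $\{\operatorname{Im}w<-|\operatorname{Re}w|\}$, giving two S-transforms, denoted $S^{+}$ and $S^{-}$ respectively. **Claim.** The measures $a^\alpha_s$, $a^\alpha_{s/4}$ and $\mu^\alpha_{s,2}$ exist. All the S-transforms above are defined on $(-1,0)$, and for $z\in(-1,0)$ the following hold, where in the symmetric case $S_{a^\alpha_s}$, $S_{a^\alpha_{s/4}}$ and $S_{\mu^\alpha_{s,2}}$ stand for $S^-$.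 1. $\displaystyle S_{a^\alpha_s}(z)=-\frac1z\Big(\frac{(1+z)^\alpha-1}{s}\Big)^{1/\alpha}$. 2. $\displaystyle S_{\mu^\alpha_{s,2}}(z)=-\frac{4^{1/\alpha}}{z(z+1)}\Big(\frac{(1+z)^\alpha-1}{s}\Big)^{1/\alpha}=S_m(z)\,S_{a^\alpha_{s/4}}(z)$. In the symmetric case the other choice changes the sign: $S^+_{a^\alpha_s}(z)=\frac1z\big(\frac{(1+z)^\alpha-1}{s}\big)^{1/\alpha}$ and $S^+_{\mu^\alpha_{s,2}}(z)=\frac{4^{1/\alpha}}{z(z+1)}\big(\frac{(1+z)^\alpha-1}{s}\big)^{1/\alpha}=S_m(z)\,S^+_{a^\alpha_{s/4}}(z)$. -/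

import Mathlib

open MeasureTheory

noncomputable section

/-- The argument of a complex number, normalised to lie in `[0, 2π)`. -/
def argTwoPi (z : ℂ) : ℝ :=
  if Complex.arg z < 0 then Complex.arg z + 2 * Real.pi else Complex.arg z

/-- The power `z ^ a = exp (a log z)`, for `z ≠ 0`, where `Im (log z) ∈ [0, 2π)`. It is analytic
on `ℂ \ [0, ∞)` and has its positive real value for `z > 0`. -/
def powTwoPi (z : ℂ) (a : ℝ) : ℂ :=
  Complex.exp ((a : ℂ) * ((Real.log ‖z‖ : ℂ) + (argTwoPi z : ℂ) * Complex.I))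

/-- The Cauchy transform `G_μ(z) = ∫ 1 / (z - x) μ(dx)`. -/
def cauchyTransform (μ : Measure ℝ) (z : ℂ) : ℂ :=
  ∫ x : ℝ, 1 / (z - (x : ℂ)) ∂μ

/-- The function `(z ^ α + (-1) ^ (α - 1) s) ^ (1 / α)`. -/
def monotoneStableF (α : ℝ) (s z : ℂ) : ℂ :=
  powTwoPi (powTwoPi z α + powTwoPi (-1) (α - 1) * s) (1 / α)

/-- `μ` is the monotone strictly `α`-stable law with parameter `s`: the probability measure on `ℝ`
whose reciprocal Cauchy transform is `(z ^ α + (-1) ^ (α - 1) s) ^ (1 / α)` on the upper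
half-plane. -/
def IsMonotoneStable (α : ℝ) (s : ℂ) (μ : Measure ℝ) : Prop :=
  IsProbabilityMeasure μ ∧
    ∀ z : ℂ, 0 < z.im → 1 / cauchyTransform μ z = monotoneStableF α s z

/-- The function `-r ^ (1/α) ((1 - (1 - s (-1/z) ^ α) ^ (1/r)) / s) ^ (1/α)`. The power `1/r` is the
principal one, the powers `α` and `1/α` have their arguments taken in `[0, 2π)`. -/
def stableBetaG (α : ℝ) (s : ℂ) (r : ℝ) (z : ℂ) : ℂ :=
  -((r ^ (1 / α) : ℝ) : ℂ) *
    powTwoPi ((1 - (1 - s * powTwoPi (-1 / z) α) ^ ((1 / r : ℝ) : ℂ)) / s) (1 / α)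

/-- `μ` is the probability measure on `ℝ` whose Cauchy transform is `stableBetaG α s r` on the upper
half-plane. -/
def IsStableBeta (α : ℝ) (s : ℂ) (r : ℝ) (μ : Measure ℝ) : Prop :=
  IsProbabilityMeasure μ ∧
    ∀ z : ℂ, 0 < z.im → cauchyTransform μ z = stableBetaG α s r z

/-- The Marchenko-Pastur (free Poisson) law with mean one, of density `√(x (4 - x)) / (2 π x)` on
`(0, 4)`. -/
def marchenkoPastur : Measure ℝ :=
  (volume.restrict (Set.Ioo (0 : ℝ) 4)).withDensity
    (fun x => ENNReal.ofReal (Real.sqrt (x * (4 - x)) / (2 * Real.pi * x)))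

/-- The moment generating function `ψ_μ(z) = ∫ z x / (1 - z x) μ(dx)`. -/
def psiTransform (μ : Measure ℝ) (z : ℂ) : ℂ :=
  ∫ x : ℝ, (z * (x : ℂ)) / (1 - z * (x : ℂ)) ∂μ

/-- The left half-plane, on which `ψ_μ` is univalent for `μ ≠ δ_0` supported on `[0, ∞)`. -/
def leftHalfPlane : Set ℂ := {w | w.re < 0}

/-- The sector `Im w > |Re w|`, on which `ψ_μ` is univalent for `μ ≠ δ_0` symmetric. -/
def upperSector : Set ℂ := {w | |w.re| < w.im}

/-- The sector `Im w < -|Re w|`, on which `ψ_μ` is also univalent for `μ ≠ δ_0` symmetric. -/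
def lowerSector : Set ℂ := {w | |w.re| < -w.im}

/-- The `S`-transform `S_μ(z) = (1 + z) / z * χ_μ(z)` of `μ`, for `z ∈ ψ_μ(D)`, where
`χ_μ : ψ_μ(D) → D` is the inverse of `ψ_μ` on `D`. The domain `D` is `leftHalfPlane` for measures
supported on `[0, ∞)`, and one of `upperSector` and `lowerSector` for symmetric measures. -/
def sTransform (D : Set ℂ) (μ : Measure ℝ) (z : ℂ) : ℂ :=
  (1 + z) / z * Function.invFunOn (psiTransform μ) D z

end

/-! ### Cauchy's theorem and integral formula on the upper half-plane -/

section HalfPlane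

open Complex Filter Topology ComplexConjugate

/-! Write `s = c exp (i (π - α (π - θ)))` with `c = |s|`; the positive case is `θ = π` and the
symmetric case is `θ = π / 2`. With `Y = c (z exp (-iθ)) ^ (-α)`, both families have the Cauchy
transform `G(z) = k(Y) ^ (-1/α) / z`, where `k(Y) = 1 + Y` for the monotone stable law and `k(Y) =
(1 + √(1 + Y)) / 2` for the other one. These are `monotoneStableF_eq` and `stableBetaG_eq`; the work
there lies in the branches of the powers.

Existence: both maps `k` move arguments towards `0`, so `arg G(z)` lies between `-arg z` and `-θ`,
hence `Im G ≤ 0`; moreover `z G(z) → 1` at infinity. By `exists_cauchyTransform_eq`, such a `G` is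
the Cauchy transform of a probability measure. That criterion is proved by Cauchy's formula for
shifts of `G`, followed by a tightness argument.

S-transforms: since `ψ(1/z) = z G(z) - 1`, the equation `ψ(1/z) = x` reads `k(Y) = b⁻¹` with `b = (1
+ x) ^ α`, that is, `Y = κ` with `κ = (1 - b) / b` or `κ = 4 (1 - b) / b ^ 2` respectively. Solving
for `z` gives `χ(x) = (κ / c) ^ (1/α) exp (-iθ)`. In the symmetric case this point lies on the
negative imaginary axis, and the other branch follows by conjugation. In the positive case it is a
negative real number, which is reached as a boundary limit once the measure is known to live on `[0,
∞)`. The extra factor in the second `κ` is accounted for by `S_m(x) = 1 / (1 + x)`, which comes from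
`ψ_m(x / (1 + x) ^ 2) = x`, and by replacing `c` with `c / 4`. -/

/-- Cauchy's theorem for the upper half-plane and a function which decays quadratically. -/
theorem integral_eq_zero_of_quadratic_decay {φ : ℂ → ℂ} {C : ℝ}
    (hc : ContinuousOn φ {u | 0 ≤ u.im}) (hd : DifferentiableOn ℂ φ {u | 0 < u.im})
    (hb : ∀ u : ℂ, 0 ≤ u.im → ‖φ u‖ ≤ C * (1 + ‖u‖ ^ 2)⁻¹) :
    Integrable (fun t : ℝ => φ t) ∧ ∫ t : ℝ, φ t = 0 := by
  have hcont : Continuous (fun t : ℝ => φ t) :=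
    hc.comp_continuous continuous_ofReal (fun t => by simp)
  have hC : 0 ≤ C := by simpa using (norm_nonneg _).trans (hb 0 (by simp))
  have hint : Integrable (fun t : ℝ => φ t) := by
    refine (integrable_inv_one_add_sq.const_mul C).mono' hcont.aestronglyMeasurable
      (Eventually.of_forall fun t => ?_)
    simpa using hb t (by simp)
  refine ⟨hint, ?_⟩
  have hlim : Tendsto (fun R : ℝ => ∫ t in (-R)..R, φ t) atTop (𝓝 (∫ t : ℝ, φ t)) :=
    intervalIntegral_tendsto_integral hint tendsto_neg_atTop_atBot tendsto_id
  refine tendsto_nhds_unique hlim ?_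
  have hle : ∀ R : ℝ, 0 < R → ∀ u : ℂ, 0 ≤ u.im → R ≤ ‖u‖ → ‖φ u‖ ≤ C * (R ^ 2)⁻¹ := by
    intro R hR u hu hRu
    refine (hb u hu).trans (mul_le_mul_of_nonneg_left ?_ hC)
    refine inv_anti₀ (by positivity) ?_
    nlinarith
  -- Contour `[-R, R] × [0, R]`: on the three sides off the real axis `|u| ≥ R`, so they contribute
  -- at most `2C/R`, `C/R` and `C/R`.
  have hbound : ∀ R : ℝ, 0 < R → ‖∫ t in (-R)..R, φ t‖ ≤ 4 * C * R⁻¹ := by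
    intro R hR
    have hrect := integral_boundary_rect_eq_zero_of_continuousOn_of_differentiableOn φ
      (-R : ℂ) (R + R * I : ℂ)
      (hc.mono fun u hu => by
        have := hu.2
        simp only [neg_im, ofReal_im, add_im, mul_im, ofReal_re, I_im, mul_one, I_re, mul_zero,
          add_zero, zero_add, neg_zero, Set.uIcc_of_le hR.le] at this
        exact this.1)
      (hd.mono fun u hu => by
        have := hu.2
        simp only [neg_im, ofReal_im, add_im, mul_im, ofReal_re, I_im, mul_one, I_re, mul_zero,
          add_zero, zero_add, neg_zero, min_eq_left hR.le] at this
        exact this.1)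
    simp only [neg_re, neg_im, ofReal_re, ofReal_im, add_re, add_im, mul_re, mul_im, I_re, I_im,
      mul_zero, mul_one, sub_zero, add_zero, zero_add, neg_zero, ofReal_zero, zero_mul,
      ofReal_neg, smul_eq_mul] at hrect
    have h1 : ‖∫ x : ℝ in (-R)..R, φ (x + R * I)‖ ≤ C * (R ^ 2)⁻¹ * |R - -R| := by
      refine intervalIntegral.norm_integral_le_of_norm_le_const fun x _ => ?_
      refine hle R hR _ (by simpa using hR.le) ?_
      refine le_trans ?_ (abs_im_le_norm _)
      simp [le_abs_self]
    have h2 : ‖∫ y : ℝ in (0 : ℝ)..R, φ (R + y * I)‖ ≤ C * (R ^ 2)⁻¹ * |R - 0| := by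
      refine intervalIntegral.norm_integral_le_of_norm_le_const fun y hy => ?_
      rw [Set.uIoc_of_le hR.le] at hy
      refine hle R hR _ (by simpa using hy.1.le) ?_
      refine le_trans ?_ (abs_re_le_norm _)
      simp [le_abs_self]
    have h3 : ‖∫ y : ℝ in (0 : ℝ)..R, φ (-R + y * I)‖ ≤ C * (R ^ 2)⁻¹ * |R - 0| := by
      refine intervalIntegral.norm_integral_le_of_norm_le_const fun y hy => ?_
      rw [Set.uIoc_of_le hR.le] at hy
      refine hle R hR _ (by simpa using hy.1.le) ?_
      refine le_trans ?_ (abs_re_le_norm _)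
      simp [le_abs_self]
    have heq : ∫ t in (-R)..R, φ t = (∫ x : ℝ in (-R)..R, φ (x + R * I))
        - I * (∫ y : ℝ in (0 : ℝ)..R, φ (R + y * I))
        + I * ∫ y : ℝ in (0 : ℝ)..R, φ (-R + y * I) := by
      linear_combination hrect
    rw [heq]
    refine (norm_add_le _ _).trans ?_
    grw [norm_sub_le]
    rw [norm_mul, norm_mul, norm_I, one_mul, one_mul]
    have e1 : |R - -R| = 2 * R := by rw [abs_of_pos (by linarith)]; ring
    have e2 : |R - 0| = R := by rw [sub_zero, abs_of_pos hR]
    rw [e1] at h1; rw [e2] at h2 h3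
    have e3 : C * (R ^ 2)⁻¹ * R = C * R⁻¹ := by field_simp
    have e4 : C * (R ^ 2)⁻¹ * (2 * R) = 2 * (C * R⁻¹) := by field_simp
    rw [e3] at h2 h3; rw [e4] at h1
    linarith
  refine squeeze_zero_norm' (a := fun R : ℝ => 4 * C * R⁻¹) ?_ ?_
  · filter_upwards [eventually_gt_atTop 0] with R hR using hbound R hR
  · simpa using (tendsto_inv_atTop_zero (𝕜 := ℝ)).const_mul (4 * C)

/-- The norms of `u - conj z` and `1 + ‖u‖` are comparable for `u` in the closed upper
half-plane. -/
theorem one_add_norm_le_mul_norm_sub_conj {z u : ℂ} (hz : 0 < z.im) (hu : 0 ≤ u.im) :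
    1 + ‖u‖ ≤ ((1 + ‖z‖) / z.im + 1) * ‖u - conj z‖ := by
  have h1 : z.im ≤ ‖u - conj z‖ := by
    refine le_trans ?_ ((le_abs_self _).trans (abs_im_le_norm _))
    simp; linarith
  have h2 : ‖u‖ ≤ ‖u - conj z‖ + ‖z‖ := by
    have := norm_add_le (u - conj z) (conj z)
    simpa using this
  have h3 : (1 + ‖z‖) ≤ (1 + ‖z‖) / z.im * ‖u - conj z‖ := by
    rw [div_mul_eq_mul_div, le_div_iff₀ hz]
    exact mul_le_mul_of_nonneg_left h1 (by positivity)
  linarith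

/-- The pole `conj z` lies in the lower half-plane, so the integrand is holomorphic above the real
axis, and the extra factor improves `O(1/u)` to quadratic decay. -/
theorem integral_div_sub_conj_eq_zero {G : ℂ → ℂ} {C : ℝ}
    (hc : ContinuousOn G {u | 0 ≤ u.im}) (hd : DifferentiableOn ℂ G {u | 0 < u.im})
    (hb : ∀ u : ℂ, 0 ≤ u.im → ‖G u‖ ≤ C / (1 + ‖u‖)) {z : ℂ} (hz : 0 < z.im) :
    Integrable (fun t : ℝ => G t / (t - conj z)) ∧ ∫ t : ℝ, G t / (t - conj z) = 0 := by
  have hC : 0 ≤ C := by simpa using (norm_nonneg _).trans (hb 0 (by simp))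
  have hne : ∀ u : ℂ, 0 ≤ u.im → u - conj z ≠ 0 := by
    intro u hu h
    have := congrArg im h
    simp at this
    linarith
  refine integral_eq_zero_of_quadratic_decay (φ := fun u => G u / (u - conj z))
    (C := C * ((1 + ‖z‖) / z.im + 1)) ?_ ?_ ?_
  · exact hc.div (by fun_prop) hne
  · exact hd.div (by fun_prop) (fun u hu => hne u (le_of_lt hu))
  · intro u hu
    have hpos : 0 < ‖u - conj z‖ := norm_pos_iff.2 (hne u hu)
    rw [norm_div, div_le_iff₀ hpos]
    have h := one_add_norm_le_mul_norm_sub_conj hz hu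
    set K := (1 + ‖z‖) / z.im + 1
    refine (hb u hu).trans ?_
    rw [div_le_iff₀ (by positivity)]
    have h2 : (1 + ‖u‖ ^ 2) ≤ (1 + ‖u‖) * (1 + ‖u‖) := by nlinarith [norm_nonneg u]
    have h3 : 1 + ‖u‖ ^ 2 ≤ (K * ‖u - conj z‖) * (1 + ‖u‖) :=
      h2.trans (mul_le_mul_of_nonneg_right h (by positivity))
    have : C * K * (1 + ‖u‖ ^ 2)⁻¹ * ‖u - conj z‖ * (1 + ‖u‖) =
        C * ((1 + ‖u‖ ^ 2)⁻¹ * (K * ‖u - conj z‖ * (1 + ‖u‖))) := by ring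
    rw [this]
    refine le_mul_of_one_le_right hC ?_
    rw [inv_mul_eq_div, one_le_div (by positivity)]
    exact h3

theorem integral_inv_normSq_sub {z : ℂ} (hz : 0 < z.im) :
    Integrable (fun t : ℝ => (((t : ℂ) - conj z) * ((t : ℂ) - z))⁻¹) ∧
    ∫ t : ℝ, (((t : ℂ) - conj z) * ((t : ℂ) - z))⁻¹ = Real.pi / z.im := by
  have key : ∀ t : ℝ, (((t : ℂ) - conj z) * ((t : ℂ) - z))⁻¹ =
      (((z.im ^ 2)⁻¹ * (1 + (z.im⁻¹ * (t - z.re)) ^ 2)⁻¹ : ℝ) : ℂ) := by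
    intro t
    have : ((t : ℂ) - conj z) * ((t : ℂ) - z) = (((t - z.re) ^ 2 + z.im ^ 2 : ℝ) : ℂ) := by
      apply Complex.ext <;> simp [pow_two] <;> ring
    rw [this, ← ofReal_inv, ← mul_inv]
    congr 2
    field_simp
    ring
  simp_rw [key]
  have hI : Integrable fun t : ℝ => (z.im ^ 2)⁻¹ * (1 + (z.im⁻¹ * (t - z.re)) ^ 2)⁻¹ := by
    refine Integrable.const_mul ?_ _
    exact ((integrable_inv_one_add_sq.comp_mul_left' (inv_ne_zero hz.ne')).comp_sub_right z.re)
  refine ⟨hI.ofReal, ?_⟩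
  rw [integral_complex_ofReal, integral_const_mul,
    integral_sub_right_eq_self (fun t : ℝ => (1 + (z.im⁻¹ * t) ^ 2)⁻¹) z.re,
    Measure.integral_comp_mul_left (fun t : ℝ => (1 + t ^ 2)⁻¹) z.im⁻¹,
    integral_univ_inv_one_add_sq, inv_inv, abs_of_pos hz, smul_eq_mul]
  push_cast
  have : (z.im : ℂ) ≠ 0 := by exact_mod_cast hz.ne'
  field_simp

/-- Cauchy's formula: remove the pole at `z` by a divided difference, and integrate the explicit
remainder with `integral_inv_normSq_sub`. -/
theorem integral_div_sub_eq {G : ℂ → ℂ} {C : ℝ}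
    (hc : ContinuousOn G {u | 0 ≤ u.im}) (hd : DifferentiableOn ℂ G {u | 0 < u.im})
    (hb : ∀ u : ℂ, 0 ≤ u.im → ‖G u‖ ≤ C / (1 + ‖u‖)) {z : ℂ} (hz : 0 < z.im) :
    Integrable (fun t : ℝ => G t / (t - z)) ∧
    ∫ t : ℝ, G t / (t - z) = 2 * Real.pi * I * G z := by
  have hC : 0 ≤ C := by simpa using (norm_nonneg _).trans (hb 0 (by simp))
  have hopen : IsOpen {u : ℂ | 0 < u.im} := isOpen_lt continuous_const continuous_im
  have hnhds : {u : ℂ | 0 ≤ u.im} ∈ 𝓝 z :=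
    mem_of_superset (hopen.mem_nhds hz) (fun u (hu : 0 < u.im) => hu.le)
  have hne : ∀ u : ℂ, 0 ≤ u.im → u - conj z ≠ 0 := by
    intro u hu h
    have := congrArg im h
    simp at this
    linarith
  -- Subtracting the constant `G z` would destroy the decay. This multiple of `1 / (u - conj z)` has
  -- the value `G z` at `z` and is still `O(1/u)`, so the divided difference of `N` decays
  -- quadratically.
  set N : ℂ → ℂ := fun u => G u - G z * (z - conj z) / (u - conj z) with hN
  have hNz : N z = 0 := by
    simp only [hN]
    rw [mul_div_assoc, div_self (hne z hz.le), mul_one, sub_self]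
  have hNd : DifferentiableOn ℂ N {u | 0 < u.im} :=
    hd.sub ((differentiableOn_const _).div (by fun_prop) (fun u hu => hne u (le_of_lt hu)))
  have hNc : ContinuousOn N {u | 0 ≤ u.im} :=
    hc.sub (continuousOn_const.div (by fun_prop) hne)
  have hdc : ContinuousOn (dslope N z) {u | 0 ≤ u.im} :=
    (continuousOn_dslope hnhds).2 ⟨hNc, hNd.differentiableAt (hopen.mem_nhds hz)⟩
  have hdd : DifferentiableOn ℂ (dslope N z) {u | 0 < u.im} :=
    (differentiableOn_dslope (hopen.mem_nhds hz)).2 hNd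
  have hval : ∀ u, u ≠ z → dslope N z u = N u / (u - z) := by
    intro u hu
    rw [dslope_of_ne _ hu, slope_def_field, hNz, sub_zero]
  set K := (1 + ‖z‖) / z.im + 1 with hK
  have hKpos : 0 < K := by positivity
  have hNb : ∀ u : ℂ, 0 ≤ u.im → ‖N u‖ ≤ (C + ‖G z * (z - conj z)‖ * K) / (1 + ‖u‖) := by
    intro u hu
    refine (norm_sub_le _ _).trans ?_
    rw [add_div]
    refine add_le_add (hb u hu) ?_
    have hpos : 0 < ‖u - conj z‖ := norm_pos_iff.2 (hne u hu)
    rw [norm_div, mul_div_assoc, div_eq_mul_inv]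
    refine mul_le_mul_of_nonneg_left ?_ (norm_nonneg _)
    rw [le_div_iff₀ (by positivity), inv_mul_le_iff₀ hpos, mul_comm]
    exact one_add_norm_le_mul_norm_sub_conj hz hu
  set C' := C + ‖G z * (z - conj z)‖ * K
  have hC' : 0 ≤ C' := by positivity
  obtain ⟨B, hB⟩ := ((isCompact_closedBall z 1).inter_right
    (isClosed_le continuous_const continuous_im)).exists_bound_of_continuousOn
    (hdc.mono Set.inter_subset_right)
  have hB0 : 0 ≤ B := (norm_nonneg _).trans (hB z ⟨by simp, hz.le⟩)
  have hdb : ∀ u : ℂ, 0 ≤ u.im → ‖dslope N z u‖ ≤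
      (C' * (2 + ‖z‖) + B * (2 + ‖z‖) ^ 2) * (1 + ‖u‖ ^ 2)⁻¹ := by
    intro u hu
    rw [← div_eq_mul_inv, le_div_iff₀ (by positivity)]
    have h1 : 1 + ‖u‖ ^ 2 ≤ (1 + ‖u‖) ^ 2 := by nlinarith [norm_nonneg u]
    refine (mul_le_mul_of_nonneg_left h1 (norm_nonneg _)).trans ?_
    have htri : ‖u‖ ≤ ‖u - z‖ + ‖z‖ := by simpa using norm_add_le (u - z) z
    by_cases hcase : ‖u - z‖ ≤ 1
    · have := hB u ⟨by simpa [dist_eq_norm] using hcase, hu⟩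
      have h2 : (1 + ‖u‖) ^ 2 ≤ (2 + ‖z‖) ^ 2 := by
        refine pow_le_pow_left₀ (by positivity) (by linarith) 2
      have h3 := mul_le_mul this h2 (by positivity) hB0
      have : 0 ≤ C' * (2 + ‖z‖) := by positivity
      linarith
    · push Not at hcase
      have huz : u ≠ z := by rintro rfl; simp at hcase; linarith
      rw [hval u huz, norm_div]
      have hpos : 0 < ‖u - z‖ := by linarith
      have h2 : 1 + ‖u‖ ≤ (2 + ‖z‖) * ‖u - z‖ := by nlinarith [norm_nonneg z]
      have h3 := hNb u hu
      rw [le_div_iff₀ (by positivity)] at h3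
      have h4 : ‖N u‖ / ‖u - z‖ * (1 + ‖u‖) ^ 2 = (‖N u‖ * (1 + ‖u‖)) * ((1 + ‖u‖) / ‖u - z‖) := by
        ring
      rw [h4]
      have h5 : (1 + ‖u‖) / ‖u - z‖ ≤ 2 + ‖z‖ := by rwa [div_le_iff₀ hpos]
      have h6 := mul_le_mul h3 h5 (by positivity) hC'
      have : 0 ≤ B * (2 + ‖z‖) ^ 2 := by positivity
      linarith
  obtain ⟨i1, e1⟩ := integral_eq_zero_of_quadratic_decay hdc hdd hdb
  obtain ⟨i2, e2⟩ := integral_inv_normSq_sub hz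
  have hsplit : (fun t : ℝ => G t / (t - z)) = fun t : ℝ => dslope N z t +
      G z * (z - conj z) * (((t : ℂ) - conj z) * ((t : ℂ) - z))⁻¹ := by
    funext t
    have htz : (t : ℂ) ≠ z := by
      intro h
      have := congrArg im h
      simp at this
      linarith
    have ht1 : (t : ℂ) - z ≠ 0 := sub_ne_zero.2 htz
    have ht2 := hne t (by simp)
    rw [hval t htz]
    simp only [hN]
    field_simp
    ring
  rw [hsplit]
  refine ⟨i1.add (i2.const_mul _), ?_⟩
  rw [integral_add i1 (i2.const_mul _), e1, integral_const_mul, e2, zero_add]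
  have h1 : z - conj z = 2 * z.im * I := by
    apply Complex.ext <;> simp <;> ring
  have : (z.im : ℂ) ≠ 0 := by exact_mod_cast hz.ne'
  rw [h1]
  field_simp

end HalfPlane

/-! ### Which functions are Cauchy transforms of probability measures -/

section HalfPlane

open Complex Filter Topology ComplexConjugate

/-- The left side is a smoothed mass of `[-y, y]`; the identity turns control of the Cauchy
transform on the imaginary axis into tightness. -/
theorem cauchyTransform_I_mul (μ : Measure ℝ) [IsProbabilityMeasure μ] {y : ℝ} (hy : 0 < y) :
    ∫ t : ℝ, y ^ 2 / (y ^ 2 + t ^ 2) ∂μ = - y * (cauchyTransform μ (y * I)).im := by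
  have hne : ∀ t : ℝ, (y * I : ℂ) - t ≠ 0 := by
    intro t h
    have := congrArg im h
    simp at this
    exact hy.ne' this
  have hint : Integrable (fun t : ℝ => 1 / ((y * I : ℂ) - t)) μ := by
    refine Integrable.of_bound (C := 1 / y) ?_ (Eventually.of_forall fun t => ?_)
    · exact (Continuous.div continuous_const (by fun_prop) hne).aestronglyMeasurable
    · rw [norm_div, norm_one]
      refine one_div_le_one_div_of_le hy ?_
      refine le_trans ?_ ((le_abs_self _).trans (abs_im_le_norm _))
      simp
  have h := integral_im hint
  rw [cauchyTransform]
  change _ = - y * RCLike.im (∫ t : ℝ, 1 / ((y * I : ℂ) - t) ∂μ)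
  rw [← h, ← integral_const_mul]
  refine integral_congr_ae (Eventually.of_forall fun t => ?_)
  have : normSq ((y * I : ℂ) - t) = y ^ 2 + t ^ 2 := by
    rw [normSq_apply]; simp; ring
  simp only [one_div, RCLike.im_to_complex, inv_im, this]
  simp
  ring

/-- A function `G` which is continuous on the closed upper half-plane, holomorphic in the open one
and `O(1 / z)` at infinity is the Cauchy transform of the density `- Im G / π`. -/
theorem integral_neg_im_div_pi_div_sub {G : ℂ → ℂ} {C : ℝ}
    (hc : ContinuousOn G {u | 0 ≤ u.im}) (hd : DifferentiableOn ℂ G {u | 0 < u.im})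
    (hb : ∀ u : ℂ, 0 ≤ u.im → ‖G u‖ ≤ C / (1 + ‖u‖)) {z : ℂ} (hz : 0 < z.im) :
    Integrable (fun t : ℝ => ((-(G t).im / Real.pi : ℝ) : ℂ) * (1 / (z - t))) ∧
    ∫ t : ℝ, ((-(G t).im / Real.pi : ℝ) : ℂ) * (1 / (z - t)) = G z := by
  obtain ⟨i1, e1⟩ := integral_div_sub_conj_eq_zero hc hd hb hz
  obtain ⟨i2, e2⟩ := integral_div_sub_eq hc hd hb hz
  have hpi : (Real.pi : ℂ) ≠ 0 := by exact_mod_cast Real.pi_ne_zero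
  have i1' : Integrable (fun t : ℝ => conj (G t / (t - conj z))) := by
    simpa using (conjCLE : ℂ →L[ℝ] ℂ).integrable_comp i1
  -- Write `Im G` as `(G - conj G) / 2i`: the `G` term gives Cauchy's formula at `z`, and the `conj
  -- G` term is the conjugate of the vanishing integral with pole at `conj z`.
  have hf : (fun t : ℝ => ((-(G t).im / Real.pi : ℝ) : ℂ) * (1 / (z - t))) =
      fun t : ℝ => (2 * Real.pi * I)⁻¹ * (G t / (t - z) - conj (G t / (t - conj z))) := by
    funext t
    have htz : (t : ℂ) - z ≠ 0 := by
      intro h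
      have := congrArg im h
      simp at this
      linarith
    have h1 : (z - t : ℂ) = -(t - z) := by ring
    have h2 : G t - conj (G t) = 2 * (G t).im * I := by
      apply Complex.ext <;> simp
      ring
    rw [map_div₀, map_sub, conj_conj, conj_ofReal, ← sub_div, h2, h1]
    push_cast
    field_simp
  rw [hf]
  refine ⟨(i2.sub i1').const_mul _, ?_⟩
  rw [integral_const_mul, integral_sub i2 i1', e2, integral_conj, e1, map_zero, sub_zero]
  field_simp

/-- The density is `-Im G / π`. Its total mass is the limit of `Re (iy G(iy))`, by monotone
convergence of the weights `y² / (y² + t²)` to `1`. -/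
theorem exists_cauchyTransform_eq_of_norm_le {G : ℂ → ℂ} {C : ℝ}
    (hc : ContinuousOn G {u | 0 ≤ u.im}) (hd : DifferentiableOn ℂ G {u | 0 < u.im})
    (hb : ∀ u : ℂ, 0 ≤ u.im → ‖G u‖ ≤ C / (1 + ‖u‖)) (him : ∀ u : ℂ, 0 ≤ u.im → (G u).im ≤ 0)
    (hlim : Tendsto (fun y : ℝ => (y * I) * G (y * I)) atTop (𝓝 1)) :
    ∃ μ : Measure ℝ, IsProbabilityMeasure μ ∧ ∀ z : ℂ, 0 < z.im → cauchyTransform μ z = G z := by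
  set f : ℝ → ℝ := fun t => -(G t).im / Real.pi with hf
  have hf0 : ∀ t, 0 ≤ f t := fun t =>
    div_nonneg (neg_nonneg.2 (him t (by simp))) Real.pi_pos.le
  have hfc : Continuous f := by
    have : Continuous (fun t : ℝ => G t) := hc.comp_continuous continuous_ofReal (fun t => by simp)
    exact ((continuous_im.comp this).neg).div_const _
  have hG := fun {z : ℂ} (hz : 0 < z.im) => integral_neg_im_div_pi_div_sub hc hd hb hz
  have hpoisson : ∀ y : ℝ, 0 < y → Integrable (fun t => f t * (y ^ 2 / (y ^ 2 + t ^ 2))) ∧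
      ∫ t, f t * (y ^ 2 / (y ^ 2 + t ^ 2)) = ((y * I) * G (y * I)).re := by
    intro y hy
    obtain ⟨i, e⟩ := hG (z := y * I) (by simpa using hy)
    have hcongr : (fun t : ℝ => f t * (y ^ 2 / (y ^ 2 + t ^ 2))) =
        fun t : ℝ => RCLike.re ((y * I : ℂ) * (((f t : ℝ) : ℂ) * (1 / (y * I - t)))) := by
      funext t
      have h0 : (y ^ 2 + t ^ 2) ≠ 0 := by positivity
      have h1 : (1 / (y * I - t) : ℂ) = ((-t / (y ^ 2 + t ^ 2) : ℝ) : ℂ)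
          + ((-y / (y ^ 2 + t ^ 2) : ℝ) : ℂ) * I := by
        have h3 : (y * I - t : ℂ) ≠ 0 := by
          intro h
          have := congrArg im h
          simp at this
          exact hy.ne' this
        have h4 : (y ^ 2 + t ^ 2 : ℂ) ≠ 0 := by exact_mod_cast h0
        push_cast
        field_simp
        ring_nf
        simp
      rw [h1]
      generalize hA : -t / (y ^ 2 + t ^ 2) = A
      generalize hB : -y / (y ^ 2 + t ^ 2) = B
      simp
      rw [← hB]
      ring
    have i' := (i.const_mul (y * I : ℂ))
    rw [hcongr]
    refine ⟨i'.re, ?_⟩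
    rw [integral_re i', integral_const_mul, e]
    simp
  set ν : Measure ℝ := volume.withDensity (fun t => ENNReal.ofReal (f t)) with hν
  have hmass : IsProbabilityMeasure ν := by
    refine ⟨?_⟩
    rw [hν, withDensity_apply _ MeasurableSet.univ, Measure.restrict_univ]
    have hmono : Tendsto (fun n : ℕ => ∫⁻ t, ENNReal.ofReal
        (f t * (((n : ℝ) + 1) ^ 2 / (((n : ℝ) + 1) ^ 2 + t ^ 2)))) atTop
        (𝓝 (∫⁻ t, ENNReal.ofReal (f t))) := by
      refine lintegral_tendsto_of_tendsto_of_monotone ?_ ?_ ?_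
      · intro n
        have : Continuous fun t : ℝ => f t * (((n : ℝ) + 1) ^ 2 / (((n : ℝ) + 1) ^ 2 + t ^ 2)) :=
          hfc.mul (Continuous.div continuous_const (by fun_prop) (fun t => by positivity))
        exact this.measurable.ennreal_ofReal.aemeasurable
      · refine Eventually.of_forall fun t n m hnm => ?_
        refine ENNReal.ofReal_le_ofReal (mul_le_mul_of_nonneg_left ?_ (hf0 t))
        have hnm' : (n : ℝ) ≤ m := by exact_mod_cast hnm
        rw [div_le_div_iff₀ (by positivity) (by positivity)]
        have : ((n : ℝ) + 1) ^ 2 ≤ ((m : ℝ) + 1) ^ 2 :=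
          pow_le_pow_left₀ (by positivity) (by linarith) 2
        nlinarith [sq_nonneg t]
      · refine Eventually.of_forall fun t => ?_
        refine ENNReal.tendsto_ofReal ?_
        have h1 : Tendsto (fun n : ℕ => ((n : ℝ) + 1) ^ 2) atTop atTop :=
          (tendsto_pow_atTop two_ne_zero).comp
            (tendsto_atTop_add_const_right _ 1 tendsto_natCast_atTop_atTop)
        have h2 : Tendsto (fun x : ℝ => x / (x + t ^ 2)) atTop (𝓝 1) := by
          have h3 : Tendsto (fun x : ℝ => 1 - t ^ 2 / (x + t ^ 2)) atTop (𝓝 (1 - 0)) :=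
            tendsto_const_nhds.sub
              (tendsto_const_nhds.div_atTop (tendsto_atTop_add_const_right _ _ tendsto_id))
          rw [sub_zero] at h3
          refine h3.congr' ?_
          filter_upwards [eventually_gt_atTop 0] with x hx
          have : x + t ^ 2 ≠ 0 := by positivity
          field_simp
          ring
        simpa using (h2.comp h1).const_mul (f t)
    refine tendsto_nhds_unique hmono ?_
    have h1 : Tendsto (fun n : ℕ => ((((n : ℝ) + 1 : ℝ) * I : ℂ) * G (((n : ℝ) + 1 : ℝ) * I)).re)
        atTop (𝓝 1) := by
      have := (continuous_re.tendsto _).comp (hlim.comp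
        (tendsto_atTop_add_const_right _ (1 : ℝ) tendsto_natCast_atTop_atTop))
      simpa [Function.comp_def] using this
    have h2 := ENNReal.tendsto_ofReal h1
    rw [ENNReal.ofReal_one] at h2
    refine h2.congr fun n => ?_
    obtain ⟨i, e⟩ := hpoisson ((n : ℝ) + 1) (by positivity)
    rw [← e, ofReal_integral_eq_lintegral_ofReal i]
    exact Eventually.of_forall fun t => mul_nonneg (hf0 t) (by positivity)
  refine ⟨ν, hmass, fun z hz => ?_⟩
  rw [cauchyTransform, hν, integral_withDensity_eq_integral_toReal_smul
    (hfc.measurable.ennreal_ofReal) (Eventually.of_forall fun t => ENNReal.ofReal_lt_top)]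
  rw [← (hG hz).2]
  refine integral_congr_ae (Eventually.of_forall fun t => ?_)
  simp only [ENNReal.toReal_ofReal (hf0 t)]
  rw [real_smul]

/-- A holomorphic map `G` from the upper half-plane to the closed lower half-plane with
`z G(z) → 1` at infinity is the Cauchy transform of a probability measure. -/
theorem exists_cauchyTransform_eq {G : ℂ → ℂ} (hd : DifferentiableOn ℂ G {u | 0 < u.im})
    (him : ∀ u : ℂ, 0 < u.im → (G u).im ≤ 0)
    (hlim : Tendsto (fun z => z * G z) (Bornology.cobounded ℂ ⊓ 𝓟 {u | 0 < u.im}) (𝓝 1)) :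
    ∃ μ : Measure ℝ, IsProbabilityMeasure μ ∧ ∀ z : ℂ, 0 < z.im → cauchyTransform μ z = G z := by
  have hopen : IsOpen {u : ℂ | 0 < u.im} := isOpen_lt continuous_const continuous_im
  obtain ⟨R, hR1, hR⟩ : ∃ R : ℝ, 1 ≤ R ∧ ∀ z : ℂ, R ≤ ‖z‖ → 0 < z.im → ‖z * G z‖ ≤ 2 := by
    have h1 : ∀ᶠ z in Bornology.cobounded ℂ ⊓ 𝓟 {u : ℂ | 0 < u.im}, ‖z * G z‖ ≤ 2 := by
      have := hlim.norm
      rw [norm_one] at this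
      exact this.eventually_le_const (by norm_num)
    rw [eventually_inf_principal, ← comap_norm_atTop, eventually_comap] at h1
    obtain ⟨R, hR⟩ := eventually_atTop.1 h1
    exact ⟨max 1 R, le_max_left _ _, fun z hz hz' => hR _ ((le_max_right _ _).trans hz) z rfl hz'⟩
  -- The prefactor is `y` and not `y + a`, so the hypothesis is corrected by `y / (y + a) = 1 - a /
  -- (y + a)`, which tends to `1`.
  have hy : ∀ a : ℝ, 0 ≤ a → Tendsto (fun y : ℝ => (y * I : ℂ) * G (y * I + a * I)) atTop (𝓝 1) := by
    intro a ha
    have h1 : Tendsto (fun y : ℝ => (y * I + a * I : ℂ)) atTop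
        (Bornology.cobounded ℂ ⊓ 𝓟 {u | 0 < u.im}) := by
      refine tendsto_inf.2 ⟨?_, ?_⟩
      · rw [← tendsto_norm_atTop_iff_cobounded]
        refine tendsto_atTop_mono (fun y => ?_) tendsto_id
        refine le_trans ?_ ((le_abs_self _).trans (abs_im_le_norm _))
        simpa using ha
      · refine tendsto_principal.2 ?_
        filter_upwards [eventually_gt_atTop 0] with y hy
        simp; linarith
    have h2 : Tendsto (fun y : ℝ => ((1 - a / (y + a) : ℝ) : ℂ)) atTop (𝓝 ((1 - 0 : ℝ) : ℂ)) :=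
      (continuous_ofReal.tendsto _).comp (tendsto_const_nhds.sub
        (tendsto_const_nhds.div_atTop (tendsto_atTop_add_const_right _ _ tendsto_id)))
    have h3 := h2.mul (hlim.comp h1)
    simp only [sub_zero, ofReal_one, one_mul] at h3
    refine h3.congr' ?_
    filter_upwards [eventually_gt_atTop 0] with y hy
    simp only [Function.comp]
    have : (y + a : ℂ) ≠ 0 := by
      have : y + a ≠ 0 := by positivity
      exact_mod_cast this
    push_cast
    field_simp
    ring
  have hshift : ∀ ε : ℝ, 0 < ε → ∃ μ : Measure ℝ, IsProbabilityMeasure μ ∧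
      ∀ z : ℂ, 0 < z.im → cauchyTransform μ z = G (z + ε * I) := by
    intro ε hε
    have hmaps : Set.MapsTo (fun u : ℂ => u + ε * I) {u | 0 ≤ u.im} {u | 0 < u.im} := by
      intro u (hu : 0 ≤ u.im)
      simp; linarith
    have hc : ContinuousOn (fun u : ℂ => G (u + ε * I)) {u | 0 ≤ u.im} :=
      hd.continuousOn.comp (by fun_prop) hmaps
    obtain ⟨B, hB⟩ := ((isCompact_closedBall (0 : ℂ) R).inter_right
      (isClosed_le continuous_const continuous_im)).exists_bound_of_continuousOn
      (hc.mono Set.inter_subset_right)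
    have hB0 : 0 ≤ B := (norm_nonneg _).trans (hB 0 ⟨by simp; linarith, by simp⟩)
    -- `B (1 + R)` serves the half-disc of radius `R`, by compactness. Outside it `1 + |u| ≤ 2 |u +
    -- iε|`, and `|z G(z)| ≤ 2` gives the `4`.
    refine exists_cauchyTransform_eq_of_norm_le (C := B * (1 + R) + 4) hc ?_ ?_ ?_ ?_
    · exact hd.comp (by fun_prop) (fun u (hu : 0 < u.im) => hmaps hu.le)
    · intro u hu
      rw [le_div_iff₀ (by positivity)]
      by_cases h : ‖u‖ ≤ R
      · have := mul_le_mul (hB u ⟨by simpa using h, hu⟩) (add_le_add_right h 1)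
          (by positivity) hB0
        linarith
      · push Not at h
        have h1 : ‖u‖ ≤ ‖u + ε * I‖ := by
          rw [norm_def, norm_def]
          refine Real.sqrt_le_sqrt ?_
          rw [normSq_apply, normSq_apply]
          simp
          nlinarith
        have h2 := hR (u + ε * I) (h.le.trans h1) (hmaps hu)
        rw [norm_mul] at h2
        have h3 : ‖G (u + ε * I)‖ * (1 + ‖u‖) ≤ 2 * (‖u + ε * I‖ * ‖G (u + ε * I)‖) := by
          nlinarith [norm_nonneg (G (u + ε * I))]
        have : 0 ≤ B * (1 + R) := by positivity
        linarith
    · exact fun u hu => him _ (hmaps hu)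
    · exact hy ε hε.le
  choose μ hμp hμ using fun n : ℕ => hshift (1 / ((n : ℝ) + 1)) (by positivity)
  let P : ℕ → ProbabilityMeasure ℝ := fun n => ⟨μ n, hμp n⟩
  have htight : IsTightMeasureSet
      {((ρ : ProbabilityMeasure ℝ) : Measure ℝ) | ρ ∈ Set.range P} := by
    rw [isTightMeasureSet_iff_exists_isCompact_measure_compl_le]
    intro ε hε
    by_cases hεtop : ε = ⊤
    · exact ⟨∅, isCompact_empty, fun _ _ => by simp [hεtop]⟩
    have hε' : 0 < ε.toReal := ENNReal.toReal_pos hε.ne' hεtop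
    have hlim' : ∀ᶠ r : ℝ in atTop, ∀ a : ℝ, 0 ≤ a → a ≤ 1 →
        1 - ε.toReal / 2 ≤ -r * (G (r * I + a * I)).im := by
      have h1 : ∀ᶠ z in Bornology.cobounded ℂ ⊓ 𝓟 {u : ℂ | 0 < u.im},
          1 - ε.toReal / 4 < (z * G z).re := by
        have := (continuous_re.tendsto _).comp hlim
        exact this.eventually_const_lt (by simp; linarith)
      rw [eventually_inf_principal, ← comap_norm_atTop, eventually_comap] at h1
      obtain ⟨R', hR'⟩ := eventually_atTop.1 h1
      -- With `δ = ε.toReal`: `-(r + a) Im G` exceeds `1 - δ/4`, and the surplus `-a Im G` is at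
      -- most `|G| ≤ 2/r ≤ δ/4` once `r ≥ 8/δ`. This is uniform in the shift `a ≤ 1`.
      filter_upwards [eventually_ge_atTop R', eventually_gt_atTop 0, eventually_ge_atTop R,
        eventually_ge_atTop (8 / ε.toReal)] with r hr1 hr2 hr4 hr3 a ha0 ha1
      have hn : ‖(r * I + a * I : ℂ)‖ = r + a := by
        rw [← add_mul, norm_mul, norm_I, mul_one, ← ofReal_add, norm_real, Real.norm_eq_abs,
          abs_of_pos (by linarith)]
      have h2 := hR' (r + a) (by linarith) (r * I + a * I) hn (by simp; linarith)
      have h3 := hR (r * I + a * I) (by rw [hn]; linarith) (by simp; linarith)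
      have h4 : ((r * I + a * I) * G (r * I + a * I)).re = -(r + a) * (G (r * I + a * I)).im := by
        simp
        ring
      rw [norm_mul, hn] at h3
      rw [h4] at h2
      have h5 : -(G (r * I + a * I)).im ≤ ‖G (r * I + a * I)‖ :=
        (neg_le_abs _).trans (abs_im_le_norm _)
      have h6 : a * -(G (r * I + a * I)).im ≤ ε.toReal / 4 := by
        have h7 : a * -(G (r * I + a * I)).im ≤ ‖G (r * I + a * I)‖ := by
          nlinarith [norm_nonneg (G (r * I + a * I))]
        have h8 : ‖G (r * I + a * I)‖ * r ≤ 2 := by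
          nlinarith [norm_nonneg (G (r * I + a * I))]
        rw [div_le_iff₀ hε'] at hr3
        by_contra hcon
        push Not at hcon
        have h9 : ε.toReal / 4 * r < ‖G (r * I + a * I)‖ * r :=
          mul_lt_mul_of_pos_right (hcon.trans_le h7) hr2
        nlinarith
      linarith
    obtain ⟨r, hr, hr0⟩ := (hlim'.and (eventually_gt_atTop 0)).exists
    refine ⟨Metric.closedBall 0 r, isCompact_closedBall _ _, ?_⟩
    rintro _ ⟨_, ⟨n, rfl⟩, rfl⟩
    change μ n _ ≤ ε
    have := hμp n
    have ha1 : (1 / ((n : ℝ) + 1)) ≤ 1 := by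
      rw [div_le_one (by positivity)]
      have : (0 : ℝ) ≤ n := Nat.cast_nonneg n
      linarith
    have h1 := hr (1 / ((n : ℝ) + 1)) (by positivity) ha1
    have h2 := cauchyTransform_I_mul (μ n) hr0
    rw [hμ n _ (by simpa using hr0)] at h2
    have hcont : Continuous fun t : ℝ => r ^ 2 / (r ^ 2 + t ^ 2) :=
      Continuous.div continuous_const (by fun_prop) (fun t => by positivity)
    have hint : Integrable (fun t : ℝ => r ^ 2 / (r ^ 2 + t ^ 2)) (μ n) := by
      refine Integrable.of_bound hcont.aestronglyMeasurable 1 (Eventually.of_forall fun t => ?_)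
      rw [Real.norm_of_nonneg (by positivity), div_le_one (by positivity)]
      nlinarith [sq_nonneg t]
    have h3 : ∫ t : ℝ, (1 - r ^ 2 / (r ^ 2 + t ^ 2)) ∂(μ n) ≤ ε.toReal / 2 := by
      rw [integral_sub (integrable_const _) hint, h2]
      simp
      simp at h1
      linarith
    have h4 : (μ n).real (Metric.closedBall 0 r)ᶜ ≤ ε.toReal := by
      -- Markov's inequality: the weight `1 - r² / (r² + t²)` is at least `1/2` when `|t| ≥ r`.
      have h5 := mul_meas_ge_le_integral_of_nonneg (μ := μ n)
        (f := fun t : ℝ => 1 - r ^ 2 / (r ^ 2 + t ^ 2))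
        (Eventually.of_forall fun t => by
          have : r ^ 2 / (r ^ 2 + t ^ 2) ≤ 1 := by
            rw [div_le_one (by positivity)]; nlinarith [sq_nonneg t]
          simpa using this) ((integrable_const _).sub hint) (1 / 2)
      have h6 : (μ n).real (Metric.closedBall 0 r)ᶜ ≤
          (μ n).real {t : ℝ | 1 / 2 ≤ 1 - r ^ 2 / (r ^ 2 + t ^ 2)} := by
        refine measureReal_mono (fun t ht => ?_)
        simp only [Set.mem_compl_iff, Metric.mem_closedBall, dist_zero_right, not_le,
          Real.norm_eq_abs] at ht
        have h7 : r ^ 2 ≤ t ^ 2 := by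
          rw [← sq_abs t]; exact pow_le_pow_left₀ hr0.le ht.le 2
        have h8 : r ^ 2 / (r ^ 2 + t ^ 2) ≤ 1 / 2 := by
          rw [div_le_div_iff₀ (by positivity) (by norm_num)]; linarith
        simp only [Set.mem_ofPred_eq]
        linarith
      have := h5.trans h3
      linarith
    rw [← ENNReal.ofReal_toReal hεtop, ← ofReal_measureReal]
    exact ENNReal.ofReal_le_ofReal h4
  have hcompact := isCompact_closure_of_isTightMeasureSet htight
  -- Compactness along a free ultrafilter yields a weak limit directly, with no subsequence to
  -- extract.
  let U : Ultrafilter ℕ := hyperfilter ℕ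
  have hUtop : (U : Filter ℕ) ≤ atTop := by
    rw [← Nat.cofinite_eq_atTop]; exact hyperfilter_le_cofinite
  obtain ⟨ρ, -, hρ⟩ := isCompact_iff_ultrafilter_le_nhds'.1 hcompact (U.map P)
    (by
      rw [Ultrafilter.mem_map]
      exact univ_mem' fun n => subset_closure ⟨n, rfl⟩)
  have hρ' : Tendsto P U (𝓝 ρ) := hρ
  refine ⟨ρ, inferInstance, fun z hz => ?_⟩
  have hne : ∀ t : ℝ, z - t ≠ 0 := by
    intro t h
    have := congrArg im h
    simp at this
    exact hz.ne' this
  let k : BoundedContinuousFunction ℝ ℂ := BoundedContinuousFunction.ofNormedAddCommGroup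
    (fun t : ℝ => 1 / (z - t)) (Continuous.div continuous_const (by fun_prop) hne) (1 / z.im)
    (fun t => by
      rw [norm_div, norm_one]
      refine one_div_le_one_div_of_le hz ?_
      refine le_trans ?_ ((le_abs_self _).trans (abs_im_le_norm _))
      simp)
  have h1 := (ProbabilityMeasure.tendsto_iff_forall_integral_rclike_tendsto ℂ).1 hρ' k
  have h2 : ∀ n, ∫ t, k t ∂(P n : Measure ℝ) = G (z + ((1 / ((n : ℝ) + 1) : ℝ) : ℂ) * I) :=
    fun n => hμ n z hz
  simp_rw [h2] at h1
  refine tendsto_nhds_unique h1 ?_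
  have h3 : Tendsto (fun n : ℕ => z + ((1 / ((n : ℝ) + 1) : ℝ) : ℂ) * I) U (𝓝 (z + (0 : ℝ) * I)) :=
    (tendsto_const_nhds.add (((continuous_ofReal.tendsto _).comp
      tendsto_one_div_add_atTop_nhds_zero_nat).mul_const I)).mono_left hUtop
  simp only [ofReal_zero, zero_mul, add_zero] at h3
  exact ((hd.differentiableAt (hopen.mem_nhds hz)).continuousAt.tendsto).comp h3

end HalfPlane

/-! ### The moment generating function and its inversion -/

section Psi

open Complex Filter Topology ComplexConjugate

theorem psiTransform_conj (μ : Measure ℝ) (w : ℂ) :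
    psiTransform μ (conj w) = conj (psiTransform μ w) := by
  rw [psiTransform, psiTransform, ← integral_conj]
  simp

theorem integrable_cauchyKernel (μ : Measure ℝ) [IsFiniteMeasure μ] {z : ℂ} (hz : 0 < z.im) :
    Integrable (fun t : ℝ => 1 / (z - t)) μ := by
  have hne : ∀ t : ℝ, z - t ≠ 0 := by
    intro t h
    have := congrArg im h
    simp at this
    exact hz.ne' this
  refine Integrable.of_bound (C := 1 / z.im) ?_ (Eventually.of_forall fun t => ?_)
  · exact (Continuous.div continuous_const (by fun_prop) hne).aestronglyMeasurable
  · rw [norm_div, norm_one]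
    refine one_div_le_one_div_of_le hz ?_
    refine le_trans ?_ ((le_abs_self _).trans (abs_im_le_norm _))
    simp

theorem psiTransform_inv (μ : Measure ℝ) [IsProbabilityMeasure μ] {z : ℂ} (hz : 0 < z.im) :
    psiTransform μ z⁻¹ = z * cauchyTransform μ z - 1 := by
  have hi := integrable_cauchyKernel μ hz
  have h : ∀ t : ℝ, (z⁻¹ * t) / (1 - z⁻¹ * t) = z * (1 / (z - t)) - 1 := by
    intro t
    have hne : z - t ≠ 0 := by
      intro h
      have := congrArg im h
      simp at this
      exact hz.ne' this
    have hz0 : z ≠ 0 := by rintro rfl; simp at hz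
    have h1 : 1 - z⁻¹ * t = z⁻¹ * (z - t) := by field_simp
    rw [h1]
    field_simp
    ring
  rw [psiTransform, cauchyTransform]
  simp_rw [h]
  rw [integral_sub (hi.const_mul z) (integrable_const _), integral_const_mul]
  simp

/-- The Poisson kernel `y / ((x - t)² + y²)` is at least `1 / (2y)` on the interval; apply Markov's
inequality. -/
theorem measureReal_Icc_le_cauchyTransform (μ : Measure ℝ) [IsProbabilityMeasure μ] (x : ℝ) {y : ℝ}
    (hy : 0 < y) :
    μ.real (Set.Icc (x - y) (x + y)) ≤ 2 * y * -(cauchyTransform μ (x + y * I)).im := by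
  have hz : 0 < (x + y * I : ℂ).im := by simpa using hy
  have hint := integrable_cauchyKernel μ hz
  have h := integral_im hint
  have him : -(cauchyTransform μ (x + y * I)).im = ∫ t : ℝ, y / ((x - t) ^ 2 + y ^ 2) ∂μ := by
    rw [cauchyTransform]
    change - RCLike.im (∫ t : ℝ, 1 / ((x + y * I : ℂ) - t) ∂μ) = _
    rw [← h, ← integral_neg]
    refine integral_congr_ae (Eventually.of_forall fun t => ?_)
    have : normSq ((x + y * I : ℂ) - t) = (x - t) ^ 2 + y ^ 2 := by
      rw [normSq_apply]; simp; ring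
    simp only [one_div, RCLike.im_to_complex, inv_im, this]
    simp
    ring
  have hint' : Integrable (fun t : ℝ => y / ((x - t) ^ 2 + y ^ 2)) μ := by
    refine Integrable.of_bound (C := 1 / y) ?_ (Eventually.of_forall fun t => ?_)
    · exact (Continuous.div continuous_const (by fun_prop)
        (fun t => by positivity)).aestronglyMeasurable
    · rw [Real.norm_of_nonneg (by positivity), div_le_div_iff₀ (by positivity) hy]
      nlinarith [sq_nonneg (x - t)]
  have h5 := mul_meas_ge_le_integral_of_nonneg (μ := μ)
    (f := fun t : ℝ => y / ((x - t) ^ 2 + y ^ 2))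
    (Eventually.of_forall fun t => by simp only [Pi.zero_apply]; positivity) hint' (1 / (2 * y))
  have h6 : μ.real (Set.Icc (x - y) (x + y)) ≤
      μ.real {t : ℝ | 1 / (2 * y) ≤ y / ((x - t) ^ 2 + y ^ 2)} := by
    refine measureReal_mono (fun t ht => ?_)
    simp only [Set.mem_ofPred_eq]
    rw [div_le_div_iff₀ (by positivity) (by positivity)]
    have : (x - t) ^ 2 ≤ y ^ 2 := by
      apply sq_le_sq'
      · linarith [ht.2]
      · linarith [ht.1]
    nlinarith
  rw [him]
  calc _ ≤ 2 * y * (1 / (2 * y) * μ.real {t : ℝ | 1 / (2 * y) ≤ y / ((x - t) ^ 2 + y ^ 2)}) := by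
        rw [← mul_assoc, mul_one_div_cancel (by positivity), one_mul]; exact h6
    _ ≤ _ := mul_le_mul_of_nonneg_left h5 (by positivity)

/-- A probability measure whose Cauchy transform has vanishing imaginary part on the negative
half-line is concentrated on `[0, ∞)`. -/
theorem measure_Iio_eq_zero_of_tendsto_im (μ : Measure ℝ) [IsProbabilityMeasure μ]
    (h : ∀ x : ℝ, x < 0 →
      Tendsto (fun y : ℝ => (cauchyTransform μ (x + y * I)).im) (𝓝[>] 0) (𝓝 0)) :
    μ (Set.Iio 0) = 0 := by
  set f : ℝ → ℝ := fun x => ProbabilityTheory.cdf μ x with hf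
  have hfr : ∀ x, f x = μ.real (Set.Iic x) := fun x => ProbabilityTheory.cdf_eq_real μ x
  have hdiff : ∀ a b : ℝ, a ≤ b → f b - f a ≤ μ.real (Set.Icc a b) := by
    intro a b hab
    rw [hfr, hfr, ← Set.Iic_union_Icc_eq_Iic hab]
    linarith [measureReal_union_le (μ := μ) (Set.Iic a) (Set.Icc a b)]
  have hmono : Monotone f := ProbabilityTheory.monotone_cdf μ
  -- An increment `k` of the distribution function is at most the mass of `[x - |k|, x + |k|]`,
  -- which is `o(|k|)` by the interval estimate. So the function is constant on the negative axis,
  -- with the value of its limit at `-∞`.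
  have hder : ∀ x : ℝ, x < 0 → HasDerivAt f 0 x := by
    intro x hx
    rw [hasDerivAt_iff_isLittleO_nhds_zero, Asymptotics.isLittleO_iff]
    intro c hc
    have h1 := ((h x hx).neg).eventually_lt_const (u := c / 2) (by simpa using by linarith)
    rw [eventually_nhdsWithin_iff, Metric.eventually_nhds_iff] at h1
    obtain ⟨δ, hδ, hδ'⟩ := h1
    filter_upwards [Metric.ball_mem_nhds (0 : ℝ) hδ] with k hk
    simp only [smul_zero, sub_zero]
    by_cases hk0 : k = 0
    · simp [hk0]
    have hkpos : 0 < |k| := abs_pos.2 hk0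
    have h2 := hδ' (y := |k|) (by simpa using hk) hkpos
    have h3 := measureReal_Icc_le_cauchyTransform μ x hkpos
    have h4 : |f (x + k) - f x| ≤ μ.real (Set.Icc (x - |k|) (x + |k|)) := by
      rcases le_total 0 k with hk1 | hk1
      · rw [abs_of_nonneg (sub_nonneg.2 (hmono (by linarith)))]
        refine (hdiff x (x + k) (by linarith)).trans (measureReal_mono (Set.Icc_subset_Icc ?_ ?_))
        · linarith
        · rw [abs_of_nonneg hk1]
      · rw [abs_sub_comm, abs_of_nonneg (sub_nonneg.2 (hmono (by linarith)))]
        refine (hdiff (x + k) x (by linarith)).trans (measureReal_mono (Set.Icc_subset_Icc ?_ ?_))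
        · rw [abs_of_nonpos hk1]; linarith
        · linarith
    rw [Real.norm_eq_abs, Real.norm_eq_abs]
    nlinarith
  have hconst : ∀ x y : ℝ, x < 0 → y < 0 → f x = f y := by
    intro x y hx hy
    refine isOpen_Iio.is_const_of_deriv_eq_zero (s := Set.Iio (0 : ℝ)) isPreconnected_Iio
      (fun z hz => (hder z hz).differentiableAt.differentiableWithinAt)
      (fun z hz => (hder z hz).deriv) hx hy
  have hzero : ∀ x : ℝ, x < 0 → f x = 0 := by
    intro x hx
    refine tendsto_nhds_unique ?_ (ProbabilityTheory.tendsto_cdf_atBot μ)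
    refine tendsto_const_nhds.congr' ?_
    filter_upwards [eventually_lt_atBot 0] with y hy using hconst x y hx hy
  have hU : Set.Iio (0 : ℝ) = ⋃ n : ℕ, Set.Iic (-(1 / ((n : ℝ) + 1))) := by
    ext x
    simp only [Set.mem_Iio, Set.mem_iUnion, Set.mem_Iic]
    constructor
    · intro hx
      obtain ⟨n, hn⟩ := exists_nat_one_div_lt (neg_pos.2 hx)
      exact ⟨n, by linarith⟩
    · rintro ⟨n, hn⟩
      have : 0 < 1 / ((n : ℝ) + 1) := by positivity
      linarith
  rw [hU]
  refine measure_iUnion_null fun n => ?_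
  have := hzero (-(1 / ((n : ℝ) + 1))) (by
    have : 0 < 1 / ((n : ℝ) + 1) := by positivity
    linarith)
  rw [hfr] at this
  rwa [measureReal_eq_zero_iff] at this

theorem one_sub_mul_ne_zero {w : ℂ} (hw : w.re < 0) {t : ℝ} (ht : 0 ≤ t) : 1 - w * t ≠ 0 := by
  intro h
  have := congrArg re h
  simp at this
  nlinarith

/-- `|1 - w t| ≥ 1 - t Re w ≥ -t Re w`. The bound does not depend on `t`, so it gives both
integrability and dominated convergence. -/
theorem norm_psiKernel_le {w : ℂ} (hw : w.re < 0) {t : ℝ} (ht : 0 ≤ t) :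
    ‖(w * t) / (1 - w * t)‖ ≤ ‖w‖ / -w.re := by
  have h0 : 0 < ‖1 - w * t‖ := norm_pos_iff.2 (one_sub_mul_ne_zero hw ht)
  have h1 : -w.re * t ≤ ‖1 - w * t‖ := by
    refine le_trans ?_ (re_le_norm _)
    simp
  rw [norm_div, norm_mul, norm_real, Real.norm_of_nonneg ht, div_le_div_iff₀ h0 (by linarith)]
  nlinarith [norm_nonneg w]

theorem ae_nonneg_of_measure_Iio {μ : Measure ℝ} (h0 : μ (Set.Iio 0) = 0) :
    ∀ᵐ t ∂μ, 0 ≤ t := by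
  rw [ae_iff]
  simpa [Set.Iio] using h0

theorem aestronglyMeasurable_psiKernel (μ : Measure ℝ) (w : ℂ) :
    AEStronglyMeasurable (fun t : ℝ => (w * t) / (1 - w * t)) μ := by
  have : Measurable (fun t : ℝ => (w * t) / (1 - w * t)) := by fun_prop
  exact this.aestronglyMeasurable

theorem integrable_psiKernel {μ : Measure ℝ} [IsFiniteMeasure μ] (h0 : μ (Set.Iio 0) = 0)
    {w : ℂ} (hw : w.re < 0) : Integrable (fun t : ℝ => (w * t) / (1 - w * t)) μ := by
  refine Integrable.of_bound (aestronglyMeasurable_psiKernel μ w) (‖w‖ / -w.re) ?_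
  filter_upwards [ae_nonneg_of_measure_Iio h0] with t ht using norm_psiKernel_le hw ht

theorem continuousAt_psiTransform {μ : Measure ℝ} [IsFiniteMeasure μ] (h0 : μ (Set.Iio 0) = 0)
    {w : ℂ} (hw : w.re < 0) : ContinuousAt (psiTransform μ) w := by
  have hn : ∀ᶠ v in 𝓝 w, v.re < w.re / 2 ∧ ‖v‖ < ‖w‖ + 1 :=
    ((continuous_re.tendsto w).eventually_lt_const (by linarith)).and
      ((continuous_norm.tendsto w).eventually_lt_const (by linarith))
  refine continuousAt_of_dominated (bound := fun _ => (‖w‖ + 1) / (-(w.re / 2)))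
    (Eventually.of_forall fun v => aestronglyMeasurable_psiKernel μ v) ?_ (integrable_const _) ?_
  · filter_upwards [hn] with v hv
    filter_upwards [ae_nonneg_of_measure_Iio h0] with t ht
    refine (norm_psiKernel_le (by linarith [hv.1]) ht).trans ?_
    exact div_le_div₀ (by positivity) hv.2.le (by linarith) (by linarith [hv.1])
  · filter_upwards [ae_nonneg_of_measure_Iio h0] with t ht
    exact ContinuousAt.div (by fun_prop) (by fun_prop) (one_sub_mul_ne_zero hw ht)

/-- On the left half-plane, `ψ_μ` takes every nonzero real value at most once if `μ` is
concentrated on `[0, ∞)`. -/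
theorem eq_of_psiTransform_eq_ofReal {μ : Measure ℝ} (h0 : μ (Set.Iio 0) = 0)
    (hint : ∀ w : ℂ, w.re < 0 → Integrable (fun t : ℝ => (w * t) / (1 - w * t)) μ)
    {x : ℝ} (hx : x ≠ 0) {w v : ℂ} (hw : w.re < 0) (hv : v.re < 0)
    (hwx : psiTransform μ w = x) (hvx : psiTransform μ v = x) : w = v := by
  have hzero : ∀ u : ℂ, psiTransform μ u = x → ¬ (∀ᵐ t ∂μ, t = 0) := by
    intro u hu hae
    refine hx ?_
    have : psiTransform μ u = 0 := by
      rw [psiTransform]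
      refine integral_eq_zero_of_ae ?_
      filter_upwards [hae] with t ht
      simp [ht]
    rw [hu] at this
    exact_mod_cast this
  -- `Im ψ(u) = Im u · ∫ t / |1 - u t|²` with a nonnegative integrand. If `Im u ≠ 0`, a real value
  -- forces the measure to sit at `0`, where `ψ` would vanish.
  have him : ∀ u : ℂ, u.re < 0 → psiTransform μ u = x → u.im = 0 := by
    intro u hu hux
    by_contra hne
    refine hzero u hux ?_
    have h1 := integral_im (hint u hu)
    have h2 : RCLike.im (psiTransform μ u) = 0 := by rw [hux]; simp
    rw [psiTransform, ← h1] at h2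
    have hker : ∀ t : ℝ, RCLike.im ((u * t) / (1 - u * t)) =
        u.im * (t / normSq (1 - u * t)) := by
      intro t
      simp only [RCLike.im_to_complex, div_im]
      simp
      ring
    have h3 : Integrable (fun t : ℝ => t / normSq (1 - u * t)) μ := by
      have := (hint u hu).im.const_mul (u.im)⁻¹
      simp_rw [hker] at this
      simpa [← mul_assoc, inv_mul_cancel₀ hne] using this
    simp_rw [hker] at h2
    rw [integral_const_mul] at h2
    have h4 := (mul_eq_zero.1 h2).resolve_left hne
    have h5 := (integral_eq_zero_iff_of_nonneg_ae ?_ h3).1 h4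
    · filter_upwards [h5, ae_nonneg_of_measure_Iio h0] with t ht ht0
      have := normSq_pos.2 (one_sub_mul_ne_zero hu ht0)
      simpa [this.ne', one_sub_mul_ne_zero hu ht0] using ht
    · filter_upwards [ae_nonneg_of_measure_Iio h0] with t ht
      exact div_nonneg ht (normSq_nonneg _)
  have hwi := him w hw hwx
  have hvi := him v hv hvx
  have hwr : w = (w.re : ℂ) := by apply Complex.ext <;> simp [hwi]
  have hvr : v = (v.re : ℂ) := by apply Complex.ext <;> simp [hvi]
  by_contra hne
  have hre : w.re - v.re ≠ 0 := by
    intro h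
    exact hne (by rw [hwr, hvr, sub_eq_zero.1 h])
  refine hzero w hwx ?_
  have hsub : ∫ t : ℝ, ((w * t) / (1 - w * t) - (v * t) / (1 - v * t)) ∂μ = 0 := by
    rw [integral_sub (hint w hw) (hint v hv)]
    change psiTransform μ w - psiTransform μ v = 0
    rw [hwx, hvx, sub_self]
  -- For real `w` and `v` the kernels differ by `w - v` times a nonnegative function, so equal
  -- values force `w = v` or a measure concentrated at `0`.
  have hker : ∀ᵐ t : ℝ ∂μ, (w * t) / (1 - w * t) - (v * t) / (1 - v * t) =
      (((w.re - v.re) * (t / ((1 - w.re * t) * (1 - v.re * t))) : ℝ) : ℂ) := by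
    filter_upwards [ae_nonneg_of_measure_Iio h0] with t ht
    have h1 := one_sub_mul_ne_zero hw ht
    have h2 := one_sub_mul_ne_zero hv ht
    rw [hwr] at h1
    rw [hvr] at h2
    nth_rewrite 1 2 [hwr]
    nth_rewrite 1 2 [hvr]
    push_cast
    rw [div_sub_div _ _ h1 h2, mul_div_assoc']
    congr 1
    ring
  rw [integral_congr_ae hker, integral_complex_ofReal] at hsub
  have hsub' := ofReal_eq_zero.1 hsub
  rw [integral_const_mul] at hsub'
  have h4 := (mul_eq_zero.1 hsub').resolve_left hre
  have h3 : Integrable (fun t : ℝ => t / ((1 - w.re * t) * (1 - v.re * t))) μ := by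
    have h6 := (((hint w hw).sub (hint v hv)).congr hker).re.const_mul (w.re - v.re)⁻¹
    simpa only [RCLike.re_to_complex, ofReal_re, ← mul_assoc, inv_mul_cancel₀ hre, one_mul] using h6
  have hpos : ∀ t : ℝ, 0 ≤ t → 0 < (1 - w.re * t) * (1 - v.re * t) := fun t ht =>
    mul_pos (by nlinarith) (by nlinarith)
  have h5 := (integral_eq_zero_iff_of_nonneg_ae ?_ h3).1 h4
  · filter_upwards [h5, ae_nonneg_of_measure_Iio h0] with t ht ht0
    have := (hpos t ht0).ne'
    rcases div_eq_zero_iff.1 ht with h | h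
    · exact h
    · exact absurd h this
  · filter_upwards [ae_nonneg_of_measure_Iio h0] with t ht
    exact div_nonneg ht (hpos t ht).le

/-- Uniqueness of the preimage of this single `z` already determines the value chosen by
`Function.invFunOn`; univalence on all of `D` is not needed. -/
theorem sTransform_eq {D : Set ℂ} {μ : Measure ℝ} {z w : ℂ} (hw : w ∈ D)
    (hz : psiTransform μ w = z) (huniq : ∀ v ∈ D, psiTransform μ v = z → v = w) :
    sTransform D μ z = (1 + z) / z * w := by
  have hex : ∃ v ∈ D, psiTransform μ v = z := ⟨w, hw, hz⟩
  rw [sTransform, huniq _ (Function.invFunOn_mem hex) (Function.invFunOn_eq hex)]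

end Psi

/-! ### The S-transform of the Marchenko–Pastur law -/

section MarchenkoPastur

open Complex Filter Topology

theorem integral_sin_sq_div {x : ℝ} (hx : |x| < 1) (hx0 : x ≠ 0) :
    ∫ φ in (0 : ℝ)..Real.pi, Real.sin φ ^ 2 / (1 - 2 * x * Real.cos φ + x ^ 2) = Real.pi / 2 := by
  have h1 : ∀ φ : ℝ, 0 < 1 - x * Real.cos φ := by
    intro φ
    have : |x * Real.cos φ| < 1 := by
      rw [abs_mul]
      exact (mul_le_of_le_one_right (abs_nonneg x) (Real.abs_cos_le_one φ)).trans_lt hx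
    linarith [(abs_lt.1 this).2]
  have hD : ∀ φ : ℝ, 0 < 1 - 2 * x * Real.cos φ + x ^ 2 := by
    intro φ
    have h2 : 1 - 2 * x * Real.cos φ + x ^ 2 =
        (1 - x * Real.cos φ) ^ 2 + (x * Real.sin φ) ^ 2 := by
      linear_combination -x ^ 2 * Real.sin_sq_add_cos_sq φ
    rw [h2]
    have := h1 φ
    positivity
  -- With `D = 1 - 2x cos φ + x²`, one has `4x² sin² φ / D = -(1 - x²)² / D + (1 + x²) + 2x cos φ`.
  -- The `arctan` expression is a primitive of the Poisson kernel `(1 - x²) / D`, continuous on the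
  -- whole line because `1 - x cos φ > 0`.
  set F : ℝ → ℝ := fun φ => (4 * x ^ 2)⁻¹ * (-(1 - x ^ 2) * (φ + 2 * Real.arctan
    (x * Real.sin φ / (1 - x * Real.cos φ))) + (1 + x ^ 2) * φ + 2 * x * Real.sin φ) with hF
  have hder : ∀ φ : ℝ, HasDerivAt F (Real.sin φ ^ 2 / (1 - 2 * x * Real.cos φ + x ^ 2)) φ := by
    intro φ
    have hq : HasDerivAt (fun φ => x * Real.sin φ / (1 - x * Real.cos φ))
        ((x * Real.cos φ * (1 - x * Real.cos φ) - x * Real.sin φ * (-(x * -Real.sin φ))) /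
          (1 - x * Real.cos φ) ^ 2) φ :=
      ((Real.hasDerivAt_sin φ).const_mul x).div
        (((Real.hasDerivAt_cos φ).const_mul x).const_sub 1) (h1 φ).ne'
    have hat := ((hasDerivAt_id φ).add (hq.arctan.const_mul 2)).const_mul (-(1 - x ^ 2))
    have hall := (((hat.add ((hasDerivAt_id φ).const_mul (1 + x ^ 2))).add
      ((Real.hasDerivAt_sin φ).const_mul (2 * x))).const_mul (4 * x ^ 2)⁻¹)
    refine hall.congr_deriv ?_
    have hs : Real.sin φ ^ 2 = 1 - Real.cos φ ^ 2 := by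
      linarith [Real.sin_sq_add_cos_sq φ]
    have hDφ := (hD φ).ne'
    have h1φ := (h1 φ).ne'
    have h2 : 1 + (x * Real.sin φ / (1 - x * Real.cos φ)) ^ 2 =
        (1 - 2 * x * Real.cos φ + x ^ 2) / (1 - x * Real.cos φ) ^ 2 := by
      field_simp
      rw [hs]
      ring
    have h3 : x * Real.cos φ * (1 - x * Real.cos φ) - x * Real.sin φ * (-(x * -Real.sin φ)) =
        x * Real.cos φ - x ^ 2 := by
      have : x * Real.sin φ * (-(x * -Real.sin φ)) = x ^ 2 * Real.sin φ ^ 2 := by ring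
      rw [this, hs]
      ring
    have h4 : 1 / ((1 - 2 * x * Real.cos φ + x ^ 2) / (1 - x * Real.cos φ) ^ 2) *
        ((x * Real.cos φ - x ^ 2) / (1 - x * Real.cos φ) ^ 2) =
        (x * Real.cos φ - x ^ 2) / (1 - 2 * x * Real.cos φ + x ^ 2) := by
      rw [one_div_div, div_mul_div_cancel₀' (pow_ne_zero 2 h1φ)]
    rw [h2, h3, hs, h4, eq_div_iff hDφ, inv_mul_eq_div, div_mul_eq_mul_div,
      div_eq_iff (by positivity)]
    have h5 := div_mul_cancel₀ (x * Real.cos φ - x ^ 2) hDφ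
    linear_combination (-(1 - x ^ 2) * 2) * h5
  have hcont : Continuous fun φ : ℝ => Real.sin φ ^ 2 / (1 - 2 * x * Real.cos φ + x ^ 2) :=
    Continuous.div (by fun_prop) (by fun_prop) (fun φ => (hD φ).ne')
  rw [intervalIntegral.integral_eq_sub_of_hasDerivAt (fun φ _ => hder φ)
    (hcont.intervalIntegrable _ _)]
  simp only [hF, Real.sin_pi, Real.sin_zero]
  simp
  field_simp
  ring

end MarchenkoPastur

section MarchenkoPastur

open Complex Filter Topology

theorem measurable_marchenkoPastur_density :
    Measurable fun x : ℝ => Real.sqrt (x * (4 - x)) / (2 * Real.pi * x) := by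
  fun_prop

theorem marchenkoPastur_Iio : marchenkoPastur (Set.Iio 0) = 0 := by
  refine withDensity_absolutelyContinuous _ _ ?_
  rw [Measure.restrict_apply measurableSet_Iio]
  convert measure_empty (μ := (volume : Measure ℝ))
  ext x
  simp only [Set.mem_inter_iff, Set.mem_Iio, Set.mem_Ioo, Set.mem_empty_iff_false, iff_false]
  rintro ⟨h1, h2, -⟩
  linarith

/-- The factor `t` of the kernel cancels the `1/t` of the density, so the integrand is bounded on
`(0, 4)`. No finiteness of the measure is used. -/
theorem integrable_psiKernel_marchenkoPastur {w : ℂ} (hw : w.re < 0) :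
    Integrable (fun t : ℝ => (w * t) / (1 - w * t)) marchenkoPastur := by
  rw [marchenkoPastur, integrable_withDensity_iff_integrable_smul'
    measurable_marchenkoPastur_density.ennreal_ofReal
    (Eventually.of_forall fun _ => ENNReal.ofReal_lt_top)]
  refine Integrable.of_bound (C := ‖w‖) ?_ ?_
  · have h1 : Measurable fun t : ℝ => (w * t) / (1 - w * t) := by fun_prop
    exact (measurable_marchenkoPastur_density.ennreal_ofReal.ennreal_toReal.smul
      h1).aestronglyMeasurable
  · filter_upwards [ae_restrict_mem measurableSet_Ioo] with t ht
    have ht0 := ht.1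
    have hpi := Real.pi_gt_three
    have h1 : 1 ≤ ‖1 - w * t‖ := by
      refine le_trans ?_ (re_le_norm _)
      simp
      nlinarith
    rw [ENNReal.toReal_ofReal (by positivity), norm_smul, Real.norm_of_nonneg (by positivity),
      norm_div, norm_mul, norm_real, Real.norm_of_nonneg ht0.le]
    have h2 : ‖w‖ * t / ‖1 - w * t‖ ≤ ‖w‖ * t := div_le_self (by positivity) h1
    have h3 : Real.sqrt (t * (4 - t)) ≤ 2 := by
      rw [Real.sqrt_le_left (by norm_num)]
      nlinarith [sq_nonneg (t - 2)]
    calc _ ≤ 2 / (2 * Real.pi * t) * (‖w‖ * t) := by gcongr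
      _ = ‖w‖ * (1 / Real.pi) := by field_simp
      _ ≤ ‖w‖ := by
        refine mul_le_of_le_one_right (norm_nonneg _) ?_
        rw [div_le_one (by linarith)]
        linarith

/-- Substitute `t = 2 - 2 cos φ`. With `r = x / (1 + x)²` the denominator becomes `1 - r t = (1 + 2x
cos φ + x²) / (1 + x)²`, so `integral_sin_sq_div` applies at `-x`. -/
theorem integral_marchenkoPastur {x : ℝ} (hx1 : -1 < x) (hx0 : x < 0) :
    ∫ t in (0 : ℝ)..4, x / (1 + x) ^ 2 * Real.sqrt (t * (4 - t)) /
      (2 * Real.pi * (1 - x / (1 + x) ^ 2 * t)) = x := by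
  set r := x / (1 + x) ^ 2 with hr
  have hx2 : 0 < 1 + x := by linarith
  have hr0 : r < 0 := div_neg_of_neg_of_pos hx0 (by positivity)
  have hpi := Real.pi_pos
  have hsubst := intervalIntegral.integral_comp_mul_deriv'' (a := 0) (b := Real.pi)
    (f := fun φ => 2 - 2 * Real.cos φ) (f' := fun φ => 2 * Real.sin φ)
    (g := fun t => r * Real.sqrt (t * (4 - t)) / (2 * Real.pi * (1 - r * t)))
    (by fun_prop)
    (fun φ _ => by
      have := ((Real.hasDerivAt_cos φ).const_mul 2).const_sub 2
      simpa using this.hasDerivWithinAt) (by fun_prop)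
    (by
      refine ContinuousOn.div (by fun_prop) (by fun_prop) ?_
      rintro _ ⟨φ, -, rfl⟩
      have : 0 < 1 - r * (2 - 2 * Real.cos φ) := by nlinarith [Real.cos_le_one φ]
      positivity)
  simp only [Real.cos_zero, Real.cos_pi, Function.comp] at hsubst
  norm_num at hsubst
  rw [← hsubst]
  have hint := integral_sin_sq_div (x := -x) (by rw [abs_neg, abs_of_neg hx0]; linarith)
    (neg_pos.2 hx0).ne'
  have hcongr : ∀ φ ∈ Set.uIcc 0 Real.pi,
      r * Real.sqrt ((2 - 2 * Real.cos φ) * (4 - (2 - 2 * Real.cos φ))) /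
        (2 * Real.pi * (1 - r * (2 - 2 * Real.cos φ))) * (2 * Real.sin φ) =
      2 * x / Real.pi * (Real.sin φ ^ 2 / (1 - 2 * -x * Real.cos φ + (-x) ^ 2)) := by
    intro φ hφ
    rw [Set.uIcc_of_le hpi.le] at hφ
    have hs := Real.sin_nonneg_of_nonneg_of_le_pi hφ.1 hφ.2
    have h1 : (2 - 2 * Real.cos φ) * (4 - (2 - 2 * Real.cos φ)) = (2 * Real.sin φ) ^ 2 := by
      linear_combination -4 * Real.sin_sq_add_cos_sq φ
    have h2 : 1 - r * (2 - 2 * Real.cos φ) =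
        (1 - 2 * -x * Real.cos φ + (-x) ^ 2) / (1 + x) ^ 2 := by
      rw [hr]
      field_simp
      ring
    have h3 : 0 < 1 - r * (2 - 2 * Real.cos φ) := by nlinarith [Real.cos_le_one φ]
    rw [h2] at h3
    have h4 : 0 < 1 - 2 * -x * Real.cos φ + (-x) ^ 2 := (div_pos_iff_of_pos_right (by positivity)).1 h3
    rw [h1, Real.sqrt_sq (by linarith), h2, hr]
    generalize 1 - 2 * -x * Real.cos φ + (-x) ^ 2 = D at h4
    field_simp
  rw [intervalIntegral.integral_congr hcongr, intervalIntegral.integral_const_mul, hint]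
  field_simp

theorem psiTransform_marchenkoPastur {x : ℝ} (hx1 : -1 < x) (hx0 : x < 0) :
    psiTransform marchenkoPastur ((x / (1 + x) ^ 2 : ℝ) : ℂ) = x := by
  have hx2 : 0 < 1 + x := by linarith
  have hr0 : x / (1 + x) ^ 2 < 0 := div_neg_of_neg_of_pos hx0 (by positivity)
  rw [psiTransform, marchenkoPastur, integral_withDensity_eq_integral_toReal_smul
    measurable_marchenkoPastur_density.ennreal_ofReal
    (Eventually.of_forall fun _ => ENNReal.ofReal_lt_top)]
  conv_rhs => rw [← integral_marchenkoPastur hx1 hx0,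
    intervalIntegral.integral_of_le (by norm_num), integral_Ioc_eq_integral_Ioo,
    ← integral_complex_ofReal]
  refine setIntegral_congr_fun measurableSet_Ioo (fun t ht => ?_)
  have ht0 := ht.1
  have hpi := Real.pi_pos
  rw [ENNReal.toReal_ofReal (by positivity), real_smul]
  have h1 : 0 < 1 - x / (1 + x) ^ 2 * t := by nlinarith
  rw [← ofReal_mul, ← ofReal_one, ← ofReal_sub, ← ofReal_div, ← ofReal_mul]
  congr 1
  generalize x / (1 + x) ^ 2 = r at *
  have h2 := h1.ne'
  rw [div_mul_div_comm, div_eq_div_iff (by positivity) (by positivity)]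
  ring

theorem psiTransform_marchenkoPastur_eq_iff {x : ℝ} (hx1 : -1 < x) (hx0 : x < 0) {w : ℂ}
    (hw : w ∈ leftHalfPlane) (h : psiTransform marchenkoPastur w = x) :
    w = ((x / (1 + x) ^ 2 : ℝ) : ℂ) :=
  eq_of_psiTransform_eq_ofReal marchenkoPastur_Iio
    (fun _ hw => integrable_psiKernel_marchenkoPastur hw) hx0.ne hw
    (by
      rw [ofReal_re]
      exact div_neg_of_neg_of_pos hx0 (pow_pos (by linarith) 2)) h
    (psiTransform_marchenkoPastur hx1 hx0)

theorem sTransform_marchenkoPastur {x : ℝ} (hx1 : -1 < x) (hx0 : x < 0) :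
    (x : ℂ) ∈ psiTransform marchenkoPastur '' leftHalfPlane ∧
    sTransform leftHalfPlane marchenkoPastur x = 1 / (1 + x) := by
  have hx2 : 0 < 1 + x := by linarith
  have hmem : ((x / (1 + x) ^ 2 : ℝ) : ℂ) ∈ leftHalfPlane := by
    change (((x / (1 + x) ^ 2 : ℝ) : ℂ)).re < 0
    rw [ofReal_re]
    exact div_neg_of_neg_of_pos hx0 (by positivity)
  refine ⟨⟨_, hmem, psiTransform_marchenkoPastur hx1 hx0⟩, ?_⟩
  rw [sTransform_eq hmem (psiTransform_marchenkoPastur hx1 hx0)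
    (fun v hv h => psiTransform_marchenkoPastur_eq_iff hx1 hx0 hv h)]
  have h1 : (x : ℂ) ≠ 0 := by exact_mod_cast hx0.ne
  have h2 : (1 + x : ℂ) ≠ 0 := by exact_mod_cast hx2.ne'
  push_cast
  field_simp

end MarchenkoPastur

/-! ### Branches of powers, sector maps and the parametrisation of the laws -/

section Stable

open Complex Filter Topology ComplexConjugate

theorem arg_exp_of_mem {ζ : ℂ} (h1 : -Real.pi < ζ.im) (h2 : ζ.im ≤ Real.pi) :
    arg (exp ζ) = ζ.im := by
  rw [← log_im, log_exp h1 h2]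

/-- Every power with argument in `[0, 2π)` is evaluated through this lemma; what remains each time
is to place an imaginary part in `[0, 2π)`. -/
theorem powTwoPi_exp {ζ : ℂ} (h1 : 0 ≤ ζ.im) (h2 : ζ.im < 2 * Real.pi) (γ : ℝ) :
    powTwoPi (exp ζ) γ = exp (γ * ζ) := by
  have harg : argTwoPi (exp ζ) = ζ.im := by
    have hpi := Real.pi_pos
    rw [argTwoPi]
    by_cases h : ζ.im ≤ Real.pi
    · rw [arg_exp_of_mem (by linarith) h, if_neg (not_lt.2 h1)]
    · push Not at h
      have : arg (exp ζ) = ζ.im - 2 * Real.pi := by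
        have h3 : exp ζ = exp (ζ - 2 * Real.pi * I) := by rw [exp_sub, exp_two_pi_mul_I, div_one]
        rw [h3, arg_exp_of_mem] <;> simp <;> linarith
      rw [this, if_pos (by linarith)]
      ring
  rw [powTwoPi, harg, norm_exp, Real.log_exp, re_add_im]

/-- A holomorphic self-map of the slit plane which moves arguments towards `0` and tends to `1` at
the origin. -/
structure IsSectorMap (k : ℂ → ℂ) : Prop where
  differentiableOn : DifferentiableOn ℂ k slitPlane
  mem_slitPlane : ∀ Y ∈ slitPlane, k Y ∈ slitPlane
  arg_mem : ∀ Y ∈ slitPlane, arg (k Y) ∈ Set.uIcc 0 (arg Y)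
  tendsto_one : Tendsto k (𝓝[slitPlane] 0) (𝓝 1)

theorem one_add_mem_slitPlane {Y : ℂ} (hY : Y ∈ slitPlane) : 1 + Y ∈ slitPlane := by
  rw [mem_slitPlane_iff] at *
  rcases hY with h | h
  · left; simp; linarith
  · right; simpa using h

/-- In `1 + Y = Y (1 + Y⁻¹)` the second factor has imaginary part of sign opposite to that of `Y`,
so it turns the argument back. The sign of `Im (1 + Y) = Im Y` prevents it from passing `0`. -/
theorem arg_one_add_mem_uIcc {Y : ℂ} (hY : Y ∈ slitPlane) : arg (1 + Y) ∈ Set.uIcc 0 (arg Y) := by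
  have hY0 : Y ≠ 0 := slitPlane_ne_zero hY
  have h0 : 1 + Y⁻¹ ≠ 0 := by
    intro h
    have h1 : Y⁻¹ = -1 := by linear_combination h
    have h2 : Y = -1 := by rw [← inv_inv Y, h1]; norm_num
    rw [h2, mem_slitPlane_iff] at hY
    norm_num at hY
  have hmul : 1 + Y = Y * (1 + Y⁻¹) := by field_simp; ring
  have hN : 0 < normSq Y := normSq_pos.2 hY0
  have him : (1 + Y⁻¹).im = -Y.im / normSq Y := by simp
  have hpi := Real.pi_pos
  rcases lt_trichotomy Y.im 0 with h | h | h
  · have hargY : arg Y < 0 := arg_neg_iff.2 h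
    have harg2 : 0 ≤ arg (1 + Y⁻¹) := arg_nonneg_iff.2 (by rw [him]; exact div_nonneg (by linarith) hN.le)
    have hsum := arg_mul hY0 h0 ⟨by linarith [neg_pi_lt_arg Y], by linarith [arg_le_pi (1 + Y⁻¹)]⟩
    have h3 : arg (1 + Y) < 0 := arg_neg_iff.2 (by simpa using h)
    rw [← hmul] at hsum
    exact Set.mem_uIcc.2 (Or.inr ⟨by linarith, h3.le⟩)
  · have hre : 0 < Y.re := by
      rw [mem_slitPlane_iff] at hY
      exact hY.resolve_right (fun h' => h' h)
    have h3 : arg (1 + Y) = 0 :=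
      arg_eq_zero_iff.2 ⟨by rw [add_re, one_re]; linarith, by simpa using h⟩
    rw [h3]
    exact Set.left_mem_uIcc
  · have hargY : 0 ≤ arg Y := arg_nonneg_iff.2 h.le
    have hargYpi : arg Y < Real.pi := lt_of_le_of_ne (arg_le_pi _) (slitPlane_arg_ne_pi hY)
    have harg2 : arg (1 + Y⁻¹) < 0 :=
      arg_neg_iff.2 (by rw [him]; exact div_neg_of_neg_of_pos (by linarith) hN)
    have hsum := arg_mul hY0 h0 ⟨by linarith [neg_pi_lt_arg (1 + Y⁻¹)], by linarith⟩
    have h3 : 0 ≤ arg (1 + Y) := arg_nonneg_iff.2 (by simpa using h.le)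
    rw [← hmul] at hsum
    exact Set.mem_uIcc.2 (Or.inl ⟨h3, by linarith⟩)

theorem uIcc_zero_trans {a b c : ℝ} (h1 : a ∈ Set.uIcc 0 b) (h2 : b ∈ Set.uIcc 0 c) :
    a ∈ Set.uIcc 0 c :=
  Set.uIcc_subset_uIcc_left h2 h1

theorem isSectorMap_one_add : IsSectorMap (fun Y => 1 + Y) where
  differentiableOn := by fun_prop
  mem_slitPlane _ := one_add_mem_slitPlane
  arg_mem _ := arg_one_add_mem_uIcc
  tendsto_one := by
    have : Tendsto (fun Y : ℂ => 1 + Y) (𝓝 0) (𝓝 (1 + 0)) := (continuous_const_add 1).tendsto 0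
    rw [add_zero] at this
    exact this.mono_left nhdsWithin_le_nhds

theorem arg_cpow_half {u : ℂ} (hu : u ≠ 0) : arg (u ^ ((1 / 2 : ℝ) : ℂ)) = arg u / 2 := by
  have hpi := Real.pi_pos
  have him : (log u * ((1 / 2 : ℝ) : ℂ)).im = arg u / 2 := by
    rw [im_mul_ofReal, log_im]
    ring
  rw [cpow_def_of_ne_zero hu, arg_exp_of_mem, him]
  · rw [him]; linarith [neg_pi_lt_arg u]
  · rw [him]; linarith [arg_le_pi u]

theorem cpow_half_mul_self {u : ℂ} (hu : u ≠ 0) :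
    u ^ ((1 / 2 : ℝ) : ℂ) * u ^ ((1 / 2 : ℝ) : ℂ) = u := by
  rw [← cpow_add _ _ hu, ← ofReal_add]
  norm_num

/-- The map `Y ↦ (1 + √(1 + Y)) / 2`. -/
noncomputable def halfOneAddSqrt (Y : ℂ) : ℂ := (1 + (1 + Y) ^ ((1 / 2 : ℝ) : ℂ)) / 2

theorem cpow_half_mem_slitPlane {u : ℂ} (hu : u ∈ slitPlane) :
    u ^ ((1 / 2 : ℝ) : ℂ) ∈ slitPlane := by
  have hu0 := slitPlane_ne_zero hu
  rw [mem_slitPlane_iff_arg, arg_cpow_half hu0]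
  refine ⟨?_, ?_⟩
  · have := arg_le_pi u
    have := Real.pi_pos
    intro h; linarith
  · rw [cpow_def_of_ne_zero hu0]; exact exp_ne_zero _

/-- Adding `1`, taking the principal root, adding `1` and halving each move arguments towards `0` or
keep them. -/
theorem isSectorMap_halfOneAddSqrt : IsSectorMap halfOneAddSqrt where
  differentiableOn := by
    have h1 : DifferentiableOn ℂ (fun Y : ℂ => (1 + Y) ^ ((1 / 2 : ℝ) : ℂ)) slitPlane :=
      DifferentiableOn.cpow (by fun_prop) (by fun_prop) (fun Y hY => one_add_mem_slitPlane hY)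
    exact (h1.const_add 1).div_const 2
  mem_slitPlane Y hY := by
    have h := one_add_mem_slitPlane (cpow_half_mem_slitPlane (one_add_mem_slitPlane hY))
    rw [mem_slitPlane_iff] at *
    rw [halfOneAddSqrt]
    rcases h with h | h
    · left; simp at h ⊢; linarith
    · right; simpa using h
  arg_mem Y hY := by
    have h1 := one_add_mem_slitPlane hY
    have h2 : arg (halfOneAddSqrt Y) = arg (1 + (1 + Y) ^ ((1 / 2 : ℝ) : ℂ)) := by
      rw [halfOneAddSqrt, div_eq_inv_mul, show ((2 : ℂ)⁻¹) = ((2⁻¹ : ℝ) : ℂ) by norm_num,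
        arg_real_mul _ (by norm_num)]
    rw [h2]
    refine uIcc_zero_trans (arg_one_add_mem_uIcc (cpow_half_mem_slitPlane h1)) ?_
    refine uIcc_zero_trans ?_ (arg_one_add_mem_uIcc hY)
    rw [arg_cpow_half (slitPlane_ne_zero h1)]
    rcases le_total 0 (arg (1 + Y)) with h | h
    · exact Set.mem_uIcc.2 (Or.inl ⟨by linarith, by linarith⟩)
    · exact Set.mem_uIcc.2 (Or.inr ⟨by linarith, by linarith⟩)
  tendsto_one := by
    have h1 : ContinuousAt halfOneAddSqrt 0 := by
      have : ContinuousAt (fun Y : ℂ => (1 + Y) ^ ((1 / 2 : ℝ) : ℂ)) 0 :=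
        ContinuousAt.cpow (by fun_prop) (by fun_prop) (by simp)
      exact (continuousAt_const.add this).div_const 2
    have h2 : halfOneAddSqrt 0 = 1 := by simp [halfOneAddSqrt]
    have h3 := h1.tendsto
    rw [h2] at h3
    exact h3.mono_left nhdsWithin_le_nhds

theorem one_add_eq_inv_iff {b : ℝ} (hb0 : 0 < b) (Y : ℂ) :
    1 + Y = (b⁻¹ : ℝ) ↔ Y = (((1 - b) / b : ℝ) : ℂ) := by
  have : (((1 - b) / b : ℝ) : ℂ) = (b⁻¹ : ℝ) - 1 := by
    rw [sub_div, div_self hb0.ne', one_div]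
    push_cast
    rfl
  rw [this, eq_sub_iff_add_eq, add_comm]

theorem halfOneAddSqrt_eq_inv_iff {b : ℝ} (hb0 : 0 < b) (hb1 : b < 1) {Y : ℂ}
    (hY : Y ∈ slitPlane) :
    halfOneAddSqrt Y = (b⁻¹ : ℝ) ↔ Y = ((4 * (1 - b) / b ^ 2 : ℝ) : ℂ) := by
  have hb : (b : ℂ) ≠ 0 := by exact_mod_cast hb0.ne'
  constructor
  · intro h
    have h1 := cpow_half_mul_self (slitPlane_ne_zero (one_add_mem_slitPlane hY))
    have h2 : (1 + Y) ^ ((1 / 2 : ℝ) : ℂ) = 2 / b - 1 := by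
      rw [halfOneAddSqrt] at h
      push_cast at h ⊢
      linear_combination 2 * h
    rw [h2] at h1
    push_cast
    have h3 : Y = (2 / b - 1) * (2 / b - 1) - 1 := by linear_combination -h1
    rw [h3]
    field_simp
    ring
  · intro h
    have h1 : 1 + Y = (((2 / b - 1) ^ 2 : ℝ) : ℂ) := by
      rw [h]
      push_cast
      field_simp
      ring
    -- This sign makes `2 / b - 1` the principal root of its square.
    have h2 : 0 ≤ 2 / b - 1 := by
      rw [sub_nonneg, le_div_iff₀ hb0]
      linarith
    rw [halfOneAddSqrt, h1, ← ofReal_cpow (by positivity), ← Real.sqrt_eq_rpow, Real.sqrt_sq h2]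
    push_cast
    field_simp
    ring

/-- The parameters of a (strictly) stable law: with `s = c exp (i (π - α (π - θ)))`, the condition
says that `0 ≤ θ ≤ π` and `max (α θ) (α (π - θ)) ≤ π`. -/
structure IsStableParam (α c θ : ℝ) : Prop where
  alpha_pos : 0 < α
  c_pos : 0 < c
  theta_nonneg : 0 ≤ θ
  theta_le : θ ≤ Real.pi
  mul_theta_le : α * θ ≤ Real.pi
  mul_pi_sub_theta_le : α * (Real.pi - θ) ≤ Real.pi

/-- The argument `c (z e ^ (- i θ)) ^ (-α)`. -/
noncomputable def stableArgument (α c θ : ℝ) (z : ℂ) : ℂ := c * exp (-α * (log z - θ * I))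

/-- The exponent `A` such that the Cauchy transform at `z` is `exp A / z`. -/
noncomputable def stableExponent (k : ℂ → ℂ) (α c θ : ℝ) (z : ℂ) : ℂ :=
  -(1 / α : ℝ) * log (k (stableArgument α c θ z))

variable {k : ℂ → ℂ} {α c θ : ℝ} {z : ℂ}

theorem log_sub_im (θ : ℝ) (z : ℂ) : (log z - θ * I).im = arg z - θ := by
  simp [log_im]

end Stable

/-! ### Existence of the laws and identification of their Cauchy transforms -/

section Stable

open Complex Filter Topology ComplexConjugate

variable {k : ℂ → ℂ} {α c θ : ℝ} {z : ℂ}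

theorem stableArgument_eq_exp (hc : 0 < c) :
    stableArgument α c θ z = exp (Real.log c - α * (log z - θ * I)) := by
  rw [stableArgument, sub_eq_add_neg _ ((α : ℂ) * _), exp_add, ← ofReal_exp, Real.exp_log hc,
    neg_mul]

theorem arg_stableArgument (hc : 0 < c) (hz : |α * (arg z - θ)| < Real.pi) :
    stableArgument α c θ z ∈ slitPlane ∧
    arg (stableArgument α c θ z) = -(α * (arg z - θ)) := by
  have him : (Real.log c - α * (log z - θ * I)).im = -(α * (arg z - θ)) := by
    rw [sub_im, ofReal_im, im_ofReal_mul, log_sub_im, zero_sub]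
  rw [abs_lt] at hz
  have harg : arg (stableArgument α c θ z) = -(α * (arg z - θ)) := by
    rw [stableArgument_eq_exp hc, arg_exp_of_mem, him]
    · rw [him]; linarith
    · rw [him]; linarith
  refine ⟨?_, harg⟩
  rw [mem_slitPlane_iff_arg, harg]
  refine ⟨by intro h; linarith, ?_⟩
  rw [stableArgument_eq_exp hc]
  exact exp_ne_zero _

/-- As `arg z` is strictly inside `(0, π)`, `α (arg z - θ)` is strictly between `-α θ ≥ -π` and `α
(π - θ) ≤ π`; thus `Y` avoids the cut. -/
theorem IsStableParam.abs_lt_of_im_pos (h : IsStableParam α c θ) (hz : 0 < z.im) :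
    |α * (arg z - θ)| < Real.pi := by
  have h1 : 0 < arg z := lt_of_le_of_ne (arg_nonneg_iff.2 hz.le)
    (fun h => hz.ne' (arg_eq_zero_iff.1 h.symm).2)
  have h2 : arg z < Real.pi := arg_lt_pi_iff.2 (Or.inr hz.ne')
  have := h.alpha_pos
  have := h.mul_theta_le
  have := h.mul_pi_sub_theta_le
  rw [abs_lt]
  constructor <;> nlinarith

/-- `arg k(Y)` lies between `0` and `arg Y = -α (arg z - θ)`; multiply by `-1/α`. Stated without `Im
z > 0`, it also covers negative real `z` when `θ = π`. -/
theorem stableExponent_im_mem (hα : 0 < α) (hc : 0 < c) (hk : IsSectorMap k)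
    (hz : |α * (arg z - θ)| < Real.pi) :
    (stableExponent k α c θ z).im ∈ Set.uIcc 0 (arg z - θ) := by
  obtain ⟨hm, ha⟩ := arg_stableArgument hc hz
  have h := hk.arg_mem _ hm
  rw [ha] at h
  have him : (stableExponent k α c θ z).im = -(arg (k (stableArgument α c θ z)) / α) := by
    rw [stableExponent, ← ofReal_neg, im_ofReal_mul, log_im]
    ring
  rw [him]
  generalize arg (k (stableArgument α c θ z)) = a at h
  rcases Set.mem_uIcc.1 h with ⟨h1, h2⟩ | ⟨h1, h2⟩
  · refine Set.mem_uIcc.2 (Or.inr ⟨?_, ?_⟩)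
    · rw [le_neg, div_le_iff₀ hα]; linarith
    · rw [neg_nonpos]; positivity
  · refine Set.mem_uIcc.2 (Or.inl ⟨?_, ?_⟩)
    · rw [neg_nonneg]; exact div_nonpos_of_nonpos_of_nonneg h2 hα.le
    · rw [neg_le, le_div_iff₀ hα]; linarith

/-- The exponential of `stableExponent` takes the value `β` in `(0, 1)` at exactly one point. -/
theorem exp_stableExponent_eq_iff (h : IsStableParam α c θ) (hk : IsSectorMap k)
    (hz0 : z ≠ 0) (hz : |α * (arg z - θ)| < Real.pi) (hz' : |arg z - θ| < Real.pi)
    {β κ : ℝ} (hβ : 0 < β) (hκ : 0 < κ)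
    (hinv : ∀ Y ∈ slitPlane, k Y = ((β ^ α)⁻¹ : ℝ) ↔ Y = κ) :
    exp (stableExponent k α c θ z) = β ↔ z = ((c / κ) ^ (1 / α) : ℝ) * exp (θ * I) := by
  have hα := h.alpha_pos
  have hc := h.c_pos
  have hα' : (α : ℂ) ≠ 0 := by exact_mod_cast hα.ne'
  obtain ⟨hm, ha⟩ := arg_stableArgument hc hz
  have hk0 := slitPlane_ne_zero (hk.mem_slitPlane _ hm)
  have hA := stableExponent_im_mem hα hc hk hz
  -- The bound on `α (arg z - θ)` does not suffice when `α < 1`; `hz'` puts the exponent in the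
  -- strip where `log` inverts `exp`.
  have hA' : |(stableExponent k α c θ z).im| < Real.pi := by
    rw [abs_lt] at *
    rcases Set.mem_uIcc.1 hA with ⟨h1, h2⟩ | ⟨h1, h2⟩ <;> constructor <;> linarith [Real.pi_pos]
  have hbpos : 0 < (β ^ α)⁻¹ := by positivity
  have hlogb : (Real.log ((β ^ α)⁻¹) : ℂ) = -α * Real.log β := by
    rw [Real.log_inv, Real.log_rpow hβ]
    push_cast; ring
  have step1 : exp (stableExponent k α c θ z) = β ↔
      k (stableArgument α c θ z) = ((β ^ α)⁻¹ : ℝ) := by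
    constructor
    · intro he
      have h1 : stableExponent k α c θ z = Real.log β := by
        rw [abs_lt] at hA'
        rw [← log_exp hA'.1 hA'.2.le, he, ofReal_log hβ.le]
      have h2 : log (k (stableArgument α c θ z)) = Real.log ((β ^ α)⁻¹) := by
        rw [stableExponent] at h1
        rw [hlogb, ← h1]
        push_cast
        field_simp
      rw [← exp_log hk0, h2, ← ofReal_exp, Real.exp_log hbpos]
    · intro he
      rw [stableExponent, he, ← ofReal_log hbpos.le, hlogb]
      have : -((1 / α : ℝ) : ℂ) * (-α * Real.log β) = Real.log β := by
        push_cast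
        field_simp
      rw [this, ← ofReal_exp, Real.exp_log hβ]
  rw [step1, hinv _ hm]
  have hlogr : Real.log ((c / κ) ^ (1 / α)) = (Real.log c - Real.log κ) / α := by
    rw [Real.log_rpow (by positivity), Real.log_div hc.ne' hκ.ne']
    ring
  have hr : 0 < (c / κ) ^ (1 / α) := by positivity
  constructor
  · intro he
    have him : (Real.log c - α * (log z - θ * I)).im = -(α * (arg z - θ)) := by
      rw [sub_im, ofReal_im, im_ofReal_mul, log_sub_im, zero_sub]
    have h1 : (Real.log c - α * (log z - θ * I) : ℂ) = Real.log κ := by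
      rw [abs_lt] at hz
      rw [stableArgument_eq_exp hc] at he
      rw [← log_exp (x := Real.log c - α * (log z - θ * I)) (by rw [him]; linarith)
        (by rw [him]; linarith), he, ofReal_log hκ.le]
    have h2 : log z = Real.log ((c / κ) ^ (1 / α)) + θ * I := by
      rw [hlogr]
      push_cast
      field_simp
      linear_combination -h1
    rw [← exp_log hz0, h2, exp_add, ← ofReal_exp, Real.exp_log hr]
  · intro he
    have h2 : log z = Real.log ((c / κ) ^ (1 / α)) + θ * I := by
      rw [he, ← Real.exp_log hr, ofReal_exp, ← exp_add, log_exp, Real.log_exp]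
      · simp; linarith [Real.pi_pos, h.theta_nonneg]
      · simpa using h.theta_le
    have h3 : (Real.log c - α * (log z - θ * I) : ℂ) = Real.log κ := by
      rw [h2, hlogr]
      push_cast
      field_simp
      ring
    rw [stableArgument_eq_exp hc, h3, ← ofReal_exp, Real.exp_log hκ]

theorem continuousWithinAt_stableExponent (hc : 0 < c) (hk : IsSectorMap k)
    {S : Set ℂ} (hlog : ContinuousWithinAt log S z) (hz : |α * (arg z - θ)| < Real.pi) :
    ContinuousWithinAt (stableExponent k α c θ) S z := by
  obtain ⟨hm, -⟩ := arg_stableArgument hc hz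
  have h1 : ContinuousWithinAt (stableArgument α c θ) S z :=
    (continuousWithinAt_const.mul
      ((continuousWithinAt_const.mul (hlog.sub continuousWithinAt_const)).cexp))
  have h2 : ContinuousAt k (stableArgument α c θ z) :=
    (hk.differentiableOn.differentiableAt (isOpen_slitPlane.mem_nhds hm)).continuousAt
  have h3 := (continuousAt_clog (hk.mem_slitPlane _ hm)).comp h2
  exact continuousWithinAt_const.mul (h3.comp_continuousWithinAt h1)

theorem differentiableOn_stableExponent (h : IsStableParam α c θ) (hk : IsSectorMap k) :
    DifferentiableOn ℂ (stableExponent k α c θ) {z | 0 < z.im} := by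
  have hlog : DifferentiableOn ℂ log {z | 0 < z.im} := fun z hz =>
    (differentiableAt_log (Or.inr (ne_of_gt hz))).differentiableWithinAt
  have h1 : DifferentiableOn ℂ (stableArgument α c θ) {z | 0 < z.im} :=
    (((hlog.sub_const _).const_mul _).cexp).const_mul _
  have hm : Set.MapsTo (stableArgument α c θ) {z | 0 < z.im} slitPlane := fun z hz =>
    (arg_stableArgument h.c_pos (h.abs_lt_of_im_pos hz)).1
  exact ((hk.differentiableOn.comp h1 hm).clog
    (fun z hz => hk.mem_slitPlane _ (hm hz))).const_mul _

theorem tendsto_exp_stableExponent (h : IsStableParam α c θ) (hk : IsSectorMap k) :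
    Tendsto (fun z => exp (stableExponent k α c θ z))
      (Bornology.cobounded ℂ ⊓ 𝓟 {z | 0 < z.im}) (𝓝 1) := by
  have hα := h.alpha_pos
  have h1 : Tendsto (stableArgument α c θ) (Bornology.cobounded ℂ ⊓ 𝓟 {z | 0 < z.im})
      (𝓝[slitPlane] 0) := by
    refine tendsto_nhdsWithin_iff.2 ⟨?_, ?_⟩
    · rw [tendsto_zero_iff_norm_tendsto_zero]
      have h2 : Tendsto (fun z : ℂ => c * ‖z‖ ^ (-α)) (Bornology.cobounded ℂ) (𝓝 (c * 0)) :=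
        ((tendsto_rpow_neg_atTop hα).comp tendsto_norm_cobounded_atTop).const_mul c
      rw [mul_zero] at h2
      refine (h2.mono_left inf_le_left).congr' ?_
      have : ∀ᶠ z in Bornology.cobounded ℂ ⊓ 𝓟 {z : ℂ | 0 < z.im}, 0 < z.im :=
        mem_inf_of_right (mem_principal_self _)
      filter_upwards [this] with z hz
      have hz0 : 0 < ‖z‖ := norm_pos_iff.2 (by rintro rfl; simp at hz)
      have hre : (-α * (log z - θ * I)).re = Real.log ‖z‖ * -α := by
        rw [← ofReal_neg, re_ofReal_mul, sub_re, log_re]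
        simp
        ring
      rw [stableArgument, norm_mul, norm_exp, norm_real, Real.norm_of_nonneg h.c_pos.le,
        hre, Real.rpow_def_of_pos hz0]
    · exact mem_inf_of_right (fun z hz => (arg_stableArgument h.c_pos (h.abs_lt_of_im_pos hz)).1)
  have h2 : Tendsto (stableExponent k α c θ) (Bornology.cobounded ℂ ⊓ 𝓟 {z | 0 < z.im})
      (𝓝 (-((1 / α : ℝ) : ℂ) * log 1)) :=
    ((hk.tendsto_one.comp h1).clog one_mem_slitPlane).const_mul _
  rw [log_one, mul_zero] at h2
  simpa using h2.cexp

/-- The argument of `exp A / z` is `Im A - arg z`, which lies between `-arg z` and `-θ`, hence in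
`[-π, 0]`. -/
theorem exists_cauchyTransform_eq_exp_stableExponent (h : IsStableParam α c θ)
    (hk : IsSectorMap k) : ∃ μ : Measure ℝ, IsProbabilityMeasure μ ∧
      ∀ z : ℂ, 0 < z.im → cauchyTransform μ z = exp (stableExponent k α c θ z) / z := by
  refine exists_cauchyTransform_eq (G := fun z => exp (stableExponent k α c θ z) / z) ?_ ?_ ?_
  · refine DifferentiableOn.div (differentiableOn_stableExponent h hk).cexp differentiableOn_id ?_
    rintro z hz rfl
    simp at hz
  · intro z hz
    have hz0 : z ≠ 0 := by rintro rfl; simp at hz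
    have him := stableExponent_im_mem h.alpha_pos h.c_pos hk (h.abs_lt_of_im_pos hz)
    have h1 : 0 < arg z := lt_of_le_of_ne (arg_nonneg_iff.2 hz.le)
      (fun h => hz.ne' (arg_eq_zero_iff.1 h.symm).2)
    have h2 : arg z < Real.pi := arg_lt_pi_iff.2 (Or.inr hz.ne')
    have := h.theta_nonneg
    have := h.theta_le
    have h3 : exp (stableExponent k α c θ z) / z = exp (stableExponent k α c θ z - log z) := by
      rw [exp_sub, exp_log hz0]
    rw [h3, exp_im, sub_im, log_im]
    refine mul_nonpos_of_nonneg_of_nonpos (Real.exp_nonneg _) ?_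
    refine Real.sin_nonpos_of_nonpos_of_neg_pi_le ?_ ?_ <;>
    rcases Set.mem_uIcc.1 him with ⟨h3, h4⟩ | ⟨h3, h4⟩ <;> linarith
  · refine (tendsto_exp_stableExponent h hk).congr' ?_
    have : ∀ᶠ z in Bornology.cobounded ℂ ⊓ 𝓟 {z : ℂ | 0 < z.im}, 0 < z.im :=
      mem_inf_of_right (mem_principal_self _)
    filter_upwards [this] with z hz
    have hz0 : z ≠ 0 := by rintro rfl; simp at hz
    rw [mul_div_cancel₀ _ hz0]

theorem IsStableParam.alpha_le_two (h : IsStableParam α c θ) : α ≤ 2 := by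
  have := h.mul_theta_le
  have := h.mul_pi_sub_theta_le
  have := Real.pi_pos
  by_contra! hcon
  nlinarith

/-- The parameter `s` of the stable law. -/
noncomputable def stableS (α c θ : ℝ) : ℂ := c * exp ((Real.pi - α * (Real.pi - θ) : ℝ) * I)

/-- Here `(-1)^(α-1) s = c exp (iαθ)`, so the base of the outer power is `z^α (1 + Y)`. Its argument
lies between `α arg z` and `α θ`, hence in `[0, 2π)`, so no branch is crossed. -/
theorem monotoneStableF_eq (h : IsStableParam α c θ) (hz : 0 < z.im) :
    monotoneStableF α (stableS α c θ) z =
      z * exp (-stableExponent (fun Y => 1 + Y) α c θ z) := by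
  have hα := h.alpha_pos
  have hα2 := h.alpha_le_two
  have hpi := Real.pi_pos
  have hα' : (α : ℂ) ≠ 0 := by exact_mod_cast hα.ne'
  have hz0 : z ≠ 0 := by rintro rfl; simp at hz
  have h1 : 0 < arg z := lt_of_le_of_ne (arg_nonneg_iff.2 hz.le)
    (fun h => hz.ne' (arg_eq_zero_iff.1 h.symm).2)
  have h2 : arg z < Real.pi := arg_lt_pi_iff.2 (Or.inr hz.ne')
  have hdom := h.abs_lt_of_im_pos hz
  obtain ⟨hm, ha⟩ := arg_stableArgument h.c_pos hdom
  have harg := arg_one_add_mem_uIcc hm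
  rw [ha] at harg
  have hne := slitPlane_ne_zero (one_add_mem_slitPlane hm)
  have e1 : powTwoPi z α = exp (α * log z) := by
    conv_lhs => rw [← exp_log hz0]
    exact powTwoPi_exp (by rw [log_im]; exact h1.le) (by rw [log_im]; linarith) α
  have e2 : powTwoPi (-1) (α - 1) = exp (((α - 1 : ℝ) : ℂ) * (Real.pi * I)) := by
    conv_lhs => rw [← exp_pi_mul_I]
    exact powTwoPi_exp (by simpa using hpi.le) (by simp; linarith) _
  have e3 : powTwoPi z α + powTwoPi (-1) (α - 1) * stableS α c θ =
      exp (α * log z + log (1 + stableArgument α c θ z)) := by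
    rw [exp_add, exp_log hne, e1, e2, stableS, mul_add, mul_one, mul_left_comm, ← exp_add,
      stableArgument, mul_left_comm (exp _), ← exp_add]
    congr 3
    push_cast
    ring
  rw [monotoneStableF, e3, powTwoPi_exp]
  · conv_rhs => enter [1]; rw [← exp_log hz0]
    rw [← exp_add, stableExponent]
    congr 1
    push_cast
    field_simp
  all_goals
    rw [add_im, im_ofReal_mul, log_im, log_im]
    have := h.mul_theta_le
    have := h.mul_pi_sub_theta_le
    have h5 : 0 ≤ α * arg z := by positivity
    have h6 : α * arg z < 2 * Real.pi := by nlinarith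
    have h7 : 0 ≤ α * θ := mul_nonneg hα.le h.theta_nonneg
    rcases Set.mem_uIcc.1 harg with ⟨h3, h4⟩ | ⟨h3, h4⟩ <;> linarith

theorem stableBetaG_eq (h : IsStableParam α c θ) (hz : 0 < z.im) :
    stableBetaG α (stableS α c θ) 2 z = exp (stableExponent halfOneAddSqrt α c θ z) / z := by
  have hα := h.alpha_pos
  have hα2 := h.alpha_le_two
  have hpi := Real.pi_pos
  have hα' : (α : ℂ) ≠ 0 := by exact_mod_cast hα.ne'
  have hc' : (c : ℂ) ≠ 0 := by exact_mod_cast h.c_pos.ne'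
  have hz0 : z ≠ 0 := by rintro rfl; simp at hz
  have h1 : 0 < arg z := lt_of_le_of_ne (arg_nonneg_iff.2 hz.le)
    (fun h => hz.ne' (arg_eq_zero_iff.1 h.symm).2)
  have h2 : arg z < Real.pi := arg_lt_pi_iff.2 (Or.inr hz.ne')
  have hdom := h.abs_lt_of_im_pos hz
  obtain ⟨hm, ha⟩ := arg_stableArgument h.c_pos hdom
  have harg := isSectorMap_halfOneAddSqrt.arg_mem _ hm
  have hne := slitPlane_ne_zero (isSectorMap_halfOneAddSqrt.mem_slitPlane _ hm)
  have hs0 : stableS α c θ ≠ 0 := mul_ne_zero hc' (exp_ne_zero _)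
  rw [ha] at harg
  have e0 : -1 / z = exp (Real.pi * I - log z) := by
    rw [exp_sub, exp_pi_mul_I, exp_log hz0]
  have e1 : powTwoPi (-1 / z) α = exp (α * (Real.pi * I - log z)) := by
    rw [e0]
    refine powTwoPi_exp ?_ ?_ α <;> simp [log_im] <;> linarith
  have e2 : stableS α c θ * powTwoPi (-1 / z) α = -stableArgument α c θ z := by
    rw [e1, stableS, stableArgument, mul_assoc, ← exp_add, neg_eq_neg_one_mul, ← exp_pi_mul_I,
      mul_left_comm, ← exp_add]
    congr 2
    push_cast
    ring
  set Y := stableArgument α c θ z with hY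
  set K := halfOneAddSqrt Y with hK
  -- Since `s (-1/z)^α = -Y`, rationalising `1 - √(1 + Y) = -Y / (2K)` turns the quotient into
  -- `(-1/z)^α / (2K)`.
  have e3 : (1 - (1 - stableS α c θ * powTwoPi (-1 / z) α) ^ ((1 / 2 : ℝ) : ℂ)) / stableS α c θ =
      exp (α * (Real.pi * I - log z) - log K - Real.log 2) := by
    rw [exp_sub, exp_sub, ← e1, exp_log hne, ← ofReal_exp, Real.exp_log two_pos]
    have hsq := cpow_half_mul_self (slitPlane_ne_zero (one_add_mem_slitPlane hm))
    have hKr : (1 + Y) ^ ((1 / 2 : ℝ) : ℂ) = 2 * K - 1 := by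
      rw [hK, halfOneAddSqrt]; ring
    rw [hKr] at hsq
    rw [e2, sub_neg_eq_add, hKr]
    have e4 : powTwoPi (-1 / z) α = -Y / stableS α c θ := by
      rw [eq_div_iff hs0, mul_comm, e2]
    rw [e4]
    push_cast
    field_simp
    linear_combination -hsq
  rw [stableBetaG, e3, powTwoPi_exp]
  · have e5 : (((2 : ℝ) ^ (1 / α) : ℝ) : ℂ) = exp ((1 / α : ℝ) * Real.log 2) := by
      rw [Real.rpow_def_of_pos two_pos, ofReal_exp]
      push_cast
      rw [mul_comm]
    rw [e5, neg_mul, ← exp_add]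
    conv_rhs => enter [2]; rw [← exp_log hz0]
    rw [← exp_sub, neg_eq_neg_one_mul, ← exp_pi_mul_I, ← exp_add, stableExponent,
      exp_eq_exp_iff_exists_int]
    -- One `πi` comes from the leading minus sign and one from `-1/z`, so the exponents differ by
    -- exactly `2πi`.
    refine ⟨1, ?_⟩
    push_cast
    field_simp
    ring
  -- The argument of the base lies between `α (π - arg z)` and `α (π - θ)`, both in `[0, 2π)`.
  all_goals
    rw [sub_im, sub_im, ofReal_im, im_ofReal_mul, sub_im, log_im, log_im]
    simp only [mul_im, ofReal_re, I_im, ofReal_im, I_re, mul_one, mul_zero, add_zero, sub_zero]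
    have := h.mul_pi_sub_theta_le
    have := h.theta_le
    have h5 : 0 ≤ α * (Real.pi - arg z) := mul_nonneg hα.le (by linarith)
    have h6 : α * (Real.pi - arg z) < 2 * Real.pi := by nlinarith
    have h7 : 0 ≤ α * (Real.pi - θ) := mul_nonneg hα.le (by linarith)
    rcases Set.mem_uIcc.1 harg with ⟨h3, h4⟩ | ⟨h3, h4⟩ <;> linarith

end Stable

/-! ### S-transforms of the stable laws -/

section Stable

open Complex Filter Topology ComplexConjugate

variable {k : ℂ → ℂ} {α c θ : ℝ} {z : ℂ} {μ : Measure ℝ}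

theorem psiTransform_of_im_neg [IsProbabilityMeasure μ]
    (hG : ∀ z : ℂ, 0 < z.im → cauchyTransform μ z = exp (stableExponent k α c θ z) / z)
    {v : ℂ} (hv : v.im < 0) : psiTransform μ v = exp (stableExponent k α c θ v⁻¹) - 1 := by
  have hv0 : v ≠ 0 := by rintro rfl; simp at hv
  have him : 0 < (v⁻¹).im := by
    rw [inv_im]
    exact div_pos (by linarith) (normSq_pos.2 hv0)
  have h := psiTransform_inv μ him
  rw [inv_inv, hG _ him, mul_div_cancel₀ _ (inv_ne_zero hv0)] at h
  exact h

theorem conj_mem_lowerSector {w : ℂ} : conj w ∈ lowerSector ↔ w ∈ upperSector := by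
  simp [lowerSector, upperSector]

theorem inv_rpow_div_eq {c κ : ℝ} (hc : 0 < c) (hκ : 0 < κ) (γ : ℝ) :
    ((c / κ) ^ γ)⁻¹ = (κ / c) ^ γ := by
  rw [← Real.inv_rpow (by positivity), inv_div]

/-- Inversion maps the lower sector into the open upper half-plane, where `G` is known, and the
unique solution `z` is on the positive imaginary axis. The upper sector follows from
`psiTransform_conj`. -/
theorem sTransform_symmetric (h : IsStableParam α c (Real.pi / 2)) (hk : IsSectorMap k)
    [IsProbabilityMeasure μ]
    (hG : ∀ z : ℂ, 0 < z.im →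
      cauchyTransform μ z = exp (stableExponent k α c (Real.pi / 2 : ℝ) z) / z)
    {x κ : ℝ} (hx : -1 < x) (hκ : 0 < κ)
    (hinv : ∀ Y ∈ slitPlane, k Y = (((1 + x) ^ α)⁻¹ : ℝ) ↔ Y = κ) :
    ((x : ℂ) ∈ psiTransform μ '' lowerSector ∧
      sTransform lowerSector μ x = (1 + x) / x * (((κ / c) ^ (1 / α) : ℝ) * -I)) ∧
    ((x : ℂ) ∈ psiTransform μ '' upperSector ∧
      sTransform upperSector μ x = (1 + x) / x * (((κ / c) ^ (1 / α) : ℝ) * I)) := by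
  have hx' : 0 < 1 + x := by linarith
  have hpi := Real.pi_pos
  have hc := h.c_pos
  set ρ : ℝ := (κ / c) ^ (1 / α) with hρ
  have hρ0 : 0 < ρ := by positivity
  have hiff : ∀ v ∈ lowerSector, psiTransform μ v = x ↔ v = ρ * -I := by
    intro v hv
    have hvim : v.im < 0 := by
      have h1 : |v.re| < -v.im := hv
      linarith [abs_nonneg v.re]
    have hv0 : v ≠ 0 := by rintro rfl; simp at hvim
    have him : 0 < (v⁻¹).im := by
      rw [inv_im]
      exact div_pos (by linarith) (normSq_pos.2 hv0)
    rw [psiTransform_of_im_neg hG hvim, sub_eq_iff_eq_add, add_comm (x : ℂ),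
      ← ofReal_one, ← ofReal_add, exp_stableExponent_eq_iff h hk (inv_ne_zero hv0)
      (h.abs_lt_of_im_pos him) (by
        have h1 : 0 ≤ arg v⁻¹ := arg_nonneg_iff.2 him.le
        have h2 := arg_le_pi v⁻¹
        rw [abs_lt]; constructor <;> linarith) hx' hκ hinv, inv_eq_iff_eq_inv, mul_inv,
      ← ofReal_inv, inv_rpow_div_eq hc hκ, ← exp_neg]
    push_cast
    rw [← neg_mul, ← neg_div, exp_neg_pi_div_two_mul_I]
  have hmem : (ρ * -I : ℂ) ∈ lowerSector := by
    change |(ρ * -I : ℂ).re| < -(ρ * -I : ℂ).im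
    simpa using hρ0
  have hmem' : (ρ * I : ℂ) ∈ upperSector := by
    change |(ρ * I : ℂ).re| < (ρ * I : ℂ).im
    simpa using hρ0
  have hconj : conj (ρ * -I : ℂ) = ρ * I := by simp
  have hval := (hiff _ hmem).2 rfl
  have hval' : psiTransform μ (ρ * I) = x := by
    rw [← hconj, psiTransform_conj, hval, conj_ofReal]
  refine ⟨⟨⟨_, hmem, hval⟩, sTransform_eq hmem hval fun v hv hvx => (hiff v hv).1 hvx⟩,
    ⟨⟨_, hmem', hval'⟩, sTransform_eq hmem' hval' fun v hv hvx => ?_⟩⟩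
  have h1 := (hiff (conj v) (conj_mem_lowerSector.2 hv)).1
    (by rw [psiTransform_conj, hvx, conj_ofReal])
  rw [← hconj, ← h1, conj_conj]

theorem tendsto_stableExponent_of_neg (h : IsStableParam α c Real.pi) (hk : IsSectorMap k)
    {x : ℝ} (hx : x < 0) :
    Tendsto (fun y : ℝ => exp (stableExponent k α c Real.pi (x + y * I))) (𝓝[>] 0)
      (𝓝 (exp (stableExponent k α c Real.pi x))) := by
  have harg : arg (x : ℂ) = Real.pi := arg_ofReal_of_neg hx
  have hc := continuousWithinAt_stableExponent (θ := Real.pi) (α := α) h.c_pos hk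
    (continuousWithinAt_log_of_re_neg_of_im_zero (z := (x : ℂ)) (by simpa using hx) (by simp))
    (by rw [harg, sub_self, mul_zero, abs_zero]; exact Real.pi_pos)
  refine (continuous_exp.tendsto _).comp (hc.tendsto.comp (tendsto_nhdsWithin_iff.2 ⟨?_, ?_⟩))
  · have : Tendsto (fun y : ℝ => (x + y * I : ℂ)) (𝓝 0) (𝓝 (x + (0 : ℝ) * I)) :=
      Continuous.tendsto (by fun_prop) 0
    simp only [ofReal_zero, zero_mul, add_zero] at this
    exact this.mono_left nhdsWithin_le_nhds
  · filter_upwards [self_mem_nhdsWithin] with y hy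
    have : (0 : ℝ) < y := hy
    simpa using this.le

/-- For `θ = π` the exponent is squeezed to a real value at negative real points, so the boundary
values of `Im G` vanish there. -/
theorem measure_Iio_eq_zero_of_stable (h : IsStableParam α c Real.pi) (hk : IsSectorMap k)
    [IsProbabilityMeasure μ]
    (hG : ∀ z : ℂ, 0 < z.im →
      cauchyTransform μ z = exp (stableExponent k α c Real.pi z) / z) :
    μ (Set.Iio 0) = 0 := by
  refine measure_Iio_eq_zero_of_tendsto_im μ fun x hx => ?_
  have harg : arg (x : ℂ) = Real.pi := arg_ofReal_of_neg hx
  have hx0 : (x : ℂ) ≠ 0 := by exact_mod_cast hx.ne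
  have him := stableExponent_im_mem h.alpha_pos h.c_pos hk (z := (x : ℂ)) (θ := Real.pi)
    (by rw [harg, sub_self, mul_zero, abs_zero]; exact Real.pi_pos)
  rw [harg, sub_self, Set.uIcc_self, Set.mem_singleton_iff] at him
  have h1 : Tendsto (fun y : ℝ => (x + y * I : ℂ)) (𝓝[>] 0) (𝓝 x) := by
    have : Tendsto (fun y : ℝ => (x + y * I : ℂ)) (𝓝 0) (𝓝 (x + (0 : ℝ) * I)) :=
      Continuous.tendsto (by fun_prop) 0
    simp only [ofReal_zero, zero_mul, add_zero] at this
    exact this.mono_left nhdsWithin_le_nhds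
  have h2 := (continuous_im.tendsto _).comp ((tendsto_stableExponent_of_neg h hk hx).div h1 hx0)
  have h3 : (exp (stableExponent k α c Real.pi x) / x).im = 0 := by
    rw [div_ofReal_im, exp_im, him, Real.sin_zero, mul_zero, zero_div]
  rw [h3] at h2
  refine h2.congr' ?_
  filter_upwards [self_mem_nhdsWithin] with y hy
  have hy' : (0 : ℝ) < y := hy
  rw [hG _ (by simpa using hy')]
  rfl

theorem sTransform_positive (h : IsStableParam α c Real.pi) (hk : IsSectorMap k)
    [IsProbabilityMeasure μ]
    (hG : ∀ z : ℂ, 0 < z.im →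
      cauchyTransform μ z = exp (stableExponent k α c Real.pi z) / z)
    {x κ : ℝ} (hx : -1 < x) (hx0 : x < 0) (hκ : 0 < κ)
    (hinv : ∀ Y ∈ slitPlane, k Y = (((1 + x) ^ α)⁻¹ : ℝ) ↔ Y = κ) :
    (x : ℂ) ∈ psiTransform μ '' leftHalfPlane ∧
      sTransform leftHalfPlane μ x = (1 + x) / x * -((κ / c) ^ (1 / α) : ℝ) := by
  have hx' : 0 < 1 + x := by linarith
  have hc := h.c_pos
  have hnull := measure_Iio_eq_zero_of_stable h hk hG
  set ρ : ℝ := (κ / c) ^ (1 / α) with hρ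
  have hρ0 : 0 < ρ := by positivity
  have hmem : (-ρ : ℂ) ∈ leftHalfPlane := by
    change (-ρ : ℂ).re < 0
    simpa using hρ0
  -- The solution `z = t` is on the boundary of the half-plane where `G` is given, so `ψ(1/t) = x`
  -- is obtained as the limit from `t + iy`, using the continuity of `ψ` at `-ρ`.
  set t : ℝ := -ρ⁻¹ with ht
  have ht0 : t < 0 := by rw [ht]; simpa using hρ0
  have htinv : ((t : ℂ))⁻¹ = -ρ := by rw [ht]; simp
  have htne : (t : ℂ) ≠ 0 := by exact_mod_cast ht0.ne
  have harg : arg (t : ℂ) = Real.pi := arg_ofReal_of_neg ht0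
  have hexp : exp (stableExponent k α c Real.pi t) = ((1 + x : ℝ) : ℂ) := by
    refine (exp_stableExponent_eq_iff h hk htne
      (by rw [harg, sub_self, mul_zero, abs_zero]; exact Real.pi_pos)
      (by rw [harg, sub_self, abs_zero]; exact Real.pi_pos) hx' hκ hinv).2 ?_
    rw [exp_pi_mul_I, ht, hρ, inv_rpow_div_eq hκ hc]
    push_cast
    ring
  have hval : psiTransform μ (-ρ) = x := by
    have h1 := tendsto_stableExponent_of_neg h hk ht0
    rw [hexp] at h1
    have h2 : Tendsto (fun y : ℝ => (t + y * I : ℂ)) (𝓝[>] 0) (𝓝 t) := by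
      have : Tendsto (fun y : ℝ => (t + y * I : ℂ)) (𝓝 0) (𝓝 (t + (0 : ℝ) * I)) :=
        Continuous.tendsto (by fun_prop) 0
      simp only [ofReal_zero, zero_mul, add_zero] at this
      exact this.mono_left nhdsWithin_le_nhds
    have h3 := h2.inv₀ htne
    rw [htinv] at h3
    have h4 := (continuousAt_psiTransform hnull hmem).tendsto.comp h3
    refine tendsto_nhds_unique h4 ?_
    have h5 := h1.sub_const 1
    have h6 : (((1 + x : ℝ) : ℂ) - 1) = x := by push_cast; ring
    rw [h6] at h5
    refine h5.congr' ?_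
    filter_upwards [self_mem_nhdsWithin] with y hy
    have hy' : (0 : ℝ) < y := hy
    have him : 0 < (t + y * I : ℂ).im := by simpa using hy'
    have hne : (t + y * I : ℂ) ≠ 0 := by
      intro h0
      rw [h0] at him
      simp at him
    simp only [Function.comp]
    rw [psiTransform_inv μ him, hG _ him, mul_div_cancel₀ _ hne]
  exact ⟨⟨_, hmem, hval⟩, sTransform_eq hmem hval fun v hv hvx =>
    eq_of_psiTransform_eq_ofReal hnull (fun _ hw => integrable_psiKernel hnull hw) hx0.ne hv hmem
      hvx hval⟩

/-- `-1/s = c⁻¹ exp (iα(π - θ))` with `α (π - θ)` in `[0, π]`, so the root has phase `π - θ`: `1` in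
the positive case and `i` in the symmetric one. -/
theorem powTwoPi_div_stableS (h : IsStableParam α c θ) {b : ℝ} (hb : b < 1) :
    powTwoPi (((b - 1 : ℝ) : ℂ) / stableS α c θ) (1 / α) =
      (((1 - b) / c) ^ (1 / α) : ℝ) * exp ((Real.pi - θ : ℝ) * I) := by
  have hα := h.alpha_pos
  have hc := h.c_pos
  have hα' : (α : ℂ) ≠ 0 := by exact_mod_cast hα.ne'
  have hc' : (c : ℂ) ≠ 0 := by exact_mod_cast hc.ne'
  have hpos : 0 < (1 - b) / c := div_pos (by linarith) hc
  have e1 : ((b - 1 : ℝ) : ℂ) / stableS α c θ =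
      exp (Real.log ((1 - b) / c) + (α * (Real.pi - θ) : ℝ) * I) := by
    have h1 : (Real.pi - α * (Real.pi - θ) : ℝ) * I =
        Real.pi * I - (α * (Real.pi - θ) : ℝ) * I := by push_cast; ring
    rw [stableS, h1, exp_sub, exp_pi_mul_I, exp_add, ← ofReal_exp, Real.exp_log hpos]
    have := exp_ne_zero ((α * (Real.pi - θ) : ℝ) * I)
    push_cast at this ⊢
    field_simp
    ring
  have him : (Real.log ((1 - b) / c) + (α * (Real.pi - θ) : ℝ) * I : ℂ).im =
      α * (Real.pi - θ) := by
    rw [add_im, ofReal_im, im_ofReal_mul, I_im]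
    ring
  have h1 : 0 ≤ α * (Real.pi - θ) := mul_nonneg hα.le (by linarith [h.theta_le])
  rw [e1, powTwoPi_exp (by rw [him]; exact h1)
    (by rw [him]; linarith [h.mul_pi_sub_theta_le, Real.pi_pos]), mul_add, exp_add,
    Real.rpow_def_of_pos hpos, ofReal_exp]
  congr 2
  · push_cast; ring
  · push_cast; field_simp

theorem isMonotoneStable_iff (h : IsStableParam α c θ) :
    IsMonotoneStable α (stableS α c θ) μ ↔ IsProbabilityMeasure μ ∧ ∀ z : ℂ, 0 < z.im →
      cauchyTransform μ z = exp (stableExponent (fun Y => 1 + Y) α c θ z) / z := by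
  refine and_congr_right fun _ => forall₂_congr fun z hz => ?_
  rw [monotoneStableF_eq h hz, one_div, inv_eq_iff_eq_inv, mul_inv, exp_neg, inv_inv,
    inv_mul_eq_div]

theorem isStableBeta_iff (h : IsStableParam α c θ) :
    IsStableBeta α (stableS α c θ) 2 μ ↔ IsProbabilityMeasure μ ∧ ∀ z : ℂ, 0 < z.im →
      cauchyTransform μ z = exp (stableExponent halfOneAddSqrt α c θ z) / z := by
  refine and_congr_right fun _ => forall₂_congr fun z hz => ?_
  rw [stableBetaG_eq h hz]

theorem rpow_one_sub_div_div {b β c : ℝ} (hα : 0 < α) (hβ : 0 < β) (hb : b = β ^ α) (hb1 : b < 1)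
    (hc : 0 < c) : ((1 - b) / b / c) ^ (1 / α) = ((1 - b) / c) ^ (1 / α) / β := by
  have hb0 : 0 < b := by rw [hb]; positivity
  have h1 : (1 - b) / b / c = (1 - b) / c / b := by field_simp
  have h2 : 0 < 1 - b := by linarith
  have h3 : b ^ (1 / α) = β := by
    rw [hb, ← Real.rpow_mul hβ.le, mul_one_div_cancel hα.ne', Real.rpow_one]
  rw [h1, Real.div_rpow (by positivity) hb0.le, h3]

theorem rpow_four_mul_one_sub_div_div {b β c : ℝ} (hα : 0 < α) (hβ : 0 < β) (hb : b = β ^ α)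
    (hb1 : b < 1) (hc : 0 < c) : (4 * (1 - b) / b ^ 2 / c) ^ (1 / α) =
      4 ^ (1 / α) * ((1 - b) / c) ^ (1 / α) / β ^ 2 := by
  have hb0 : 0 < b := by rw [hb]; positivity
  have h2 : 0 < 1 - b := by linarith
  have h1 : 4 * (1 - b) / b ^ 2 / c = 4 * ((1 - b) / c) / (b * b) := by field_simp
  have h3 : b ^ (1 / α) = β := by
    rw [hb, ← Real.rpow_mul hβ.le, mul_one_div_cancel hα.ne', Real.rpow_one]
  rw [h1, Real.div_rpow (by positivity) (by positivity), Real.mul_rpow (by norm_num) (by positivity),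
    Real.mul_rpow hb0.le hb0.le, h3, pow_two]

theorem rpow_one_sub_div_div_four {b β c : ℝ} (hα : 0 < α) (hβ : 0 < β) (hb : b = β ^ α)
    (hb1 : b < 1) (hc : 0 < c) : ((1 - b) / b / (c / 4)) ^ (1 / α) =
      4 ^ (1 / α) * ((1 - b) / c) ^ (1 / α) / β := by
  have h2 : 0 < 1 - b := by linarith
  rw [rpow_one_sub_div_div hα hβ hb hb1 (by positivity), div_div_eq_mul_div, mul_comm (1 - b),
    mul_div_assoc, Real.mul_rpow (by norm_num) (by positivity)]

/-- Solve `arg s = π - α (π - θ)` for `θ`. The condition `α θ ≤ π` becomes `α ≤ 1` for `θ = π` and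
`α ≤ 2` for `θ = π / 2`. -/
theorem exists_isStableParam {s : ℂ} (hs : s ≠ 0)
    (h : (0 < α ∧ α ≤ 1 ∧ (s.arg = (1 - α / 2) * Real.pi ∨ s.arg = Real.pi)) ∨
      (1 < α ∧ α ≤ 2 ∧ s.arg = (1 - α / 2) * Real.pi)) :
    ∃ c θ : ℝ, IsStableParam α c θ ∧ s = stableS α c θ ∧
      ((s.arg = Real.pi ∧ θ = Real.pi) ∨ (s.arg = (1 - α / 2) * Real.pi ∧ θ = Real.pi / 2)) := by
  have hpi := Real.pi_pos
  have hc : 0 < ‖s‖ := norm_pos_iff.2 hs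
  have hform : ∀ θ : ℝ, s.arg = Real.pi - α * (Real.pi - θ) → s = stableS α ‖s‖ θ := by
    intro θ hθ
    rw [stableS, ← hθ, norm_mul_exp_arg_mul_I]
  have hcase : (0 < α ∧ α ≤ 1 ∧ s.arg = Real.pi) ∨
      (0 < α ∧ α ≤ 2 ∧ s.arg = (1 - α / 2) * Real.pi) := by
    rcases h with ⟨h1, h2, h3 | h3⟩ | ⟨h1, h2, h3⟩
    · exact Or.inr ⟨h1, by linarith, h3⟩
    · exact Or.inl ⟨h1, h2, h3⟩
    · exact Or.inr ⟨by linarith, h2, h3⟩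
  rcases hcase with ⟨h1, h2, h3⟩ | ⟨h1, h2, h3⟩
  · exact ⟨‖s‖, Real.pi, ⟨h1, hc, hpi.le, le_rfl, by nlinarith, by simpa using hpi.le⟩,
      hform _ (by rw [h3]; ring), Or.inl ⟨h3, rfl⟩⟩
  · exact ⟨‖s‖, Real.pi / 2, ⟨h1, hc, by linarith, by linarith, by nlinarith, by nlinarith⟩,
      hform _ (by rw [h3]; ring), Or.inr ⟨h3, rfl⟩⟩

theorem IsStableParam.div_four (h : IsStableParam α c θ) : IsStableParam α (c / 4) θ :=
  { h with c_pos := by have := h.c_pos; positivity }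

theorem stableS_div_four : stableS α c θ / 4 = stableS α (c / 4) θ := by
  rw [stableS, stableS]
  push_cast
  ring

end Stable

/-! ### The main theorem -/

theorem proposition4p4 (α : ℝ) (s : ℂ) (hs : s ≠ 0)
    (h : (0 < α ∧ α ≤ 1 ∧ (s.arg = (1 - α / 2) * Real.pi ∨ s.arg = Real.pi)) ∨
      (1 < α ∧ α ≤ 2 ∧ s.arg = (1 - α / 2) * Real.pi)) :
    -- the laws in question exist
    (∃ a, IsMonotoneStable α s a) ∧ (∃ a', IsMonotoneStable α (s / 4) a') ∧
    (∃ μ, IsStableBeta α s 2 μ) ∧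
    ∀ a a' μ : Measure ℝ, IsMonotoneStable α s a → IsMonotoneStable α (s / 4) a' →
      IsStableBeta α s 2 μ → ∀ x : ℝ, x ∈ Set.Ioo (-1 : ℝ) 0 →
      -- `x` lies in the domain of the S-transform of the Marchenko-Pastur law
      (x : ℂ) ∈ psiTransform marchenkoPastur '' leftHalfPlane ∧
      -- the positive case
      (s.arg = Real.pi →
        (x : ℂ) ∈ psiTransform a '' leftHalfPlane ∧
        (x : ℂ) ∈ psiTransform a' '' leftHalfPlane ∧
        (x : ℂ) ∈ psiTransform μ '' leftHalfPlane ∧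
        sTransform leftHalfPlane a x =
          -(1 / (x : ℂ)) * powTwoPi ((((1 + x) ^ α - 1 : ℝ) : ℂ) / s) (1 / α) ∧
        sTransform leftHalfPlane μ x =
          -(((4 : ℝ) ^ (1 / α) : ℝ) : ℂ) / ((x : ℂ) * ((x : ℂ) + 1)) *
            powTwoPi ((((1 + x) ^ α - 1 : ℝ) : ℂ) / s) (1 / α) ∧
        sTransform leftHalfPlane μ x =
          sTransform leftHalfPlane marchenkoPastur x * sTransform leftHalfPlane a' x) ∧
      -- the symmetric case, for both choices of the branch of the S-transform
      (s.arg = (1 - α / 2) * Real.pi →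
        ((x : ℂ) ∈ psiTransform a '' lowerSector ∧
        (x : ℂ) ∈ psiTransform a' '' lowerSector ∧
        (x : ℂ) ∈ psiTransform μ '' lowerSector ∧
        sTransform lowerSector a x =
          -(1 / (x : ℂ)) * powTwoPi ((((1 + x) ^ α - 1 : ℝ) : ℂ) / s) (1 / α) ∧
        sTransform lowerSector μ x =
          -(((4 : ℝ) ^ (1 / α) : ℝ) : ℂ) / ((x : ℂ) * ((x : ℂ) + 1)) *
            powTwoPi ((((1 + x) ^ α - 1 : ℝ) : ℂ) / s) (1 / α) ∧
        sTransform lowerSector μ x =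
          sTransform leftHalfPlane marchenkoPastur x * sTransform lowerSector a' x) ∧
        ((x : ℂ) ∈ psiTransform a '' upperSector ∧
        (x : ℂ) ∈ psiTransform a' '' upperSector ∧
        (x : ℂ) ∈ psiTransform μ '' upperSector ∧
        sTransform upperSector a x =
          (1 / (x : ℂ)) * powTwoPi ((((1 + x) ^ α - 1 : ℝ) : ℂ) / s) (1 / α) ∧
        sTransform upperSector μ x =
          (((4 : ℝ) ^ (1 / α) : ℝ) : ℂ) / ((x : ℂ) * ((x : ℂ) + 1)) *
            powTwoPi ((((1 + x) ^ α - 1 : ℝ) : ℂ) / s) (1 / α) ∧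
        sTransform upperSector μ x =
          sTransform leftHalfPlane marchenkoPastur x * sTransform upperSector a' x)) := by
  obtain ⟨c, θ, hp, rfl, hcases⟩ := exists_isStableParam hs h
  have hp4 := hp.div_four
  have hα := hp.alpha_pos
  have hc := hp.c_pos
  have hpi := Real.pi_pos
  rw [stableS_div_four]
  simp only [isMonotoneStable_iff hp, isMonotoneStable_iff hp4, isStableBeta_iff hp]
  refine ⟨exists_cauchyTransform_eq_exp_stableExponent hp isSectorMap_one_add,
    exists_cauchyTransform_eq_exp_stableExponent hp4 isSectorMap_one_add,
    exists_cauchyTransform_eq_exp_stableExponent hp isSectorMap_halfOneAddSqrt, ?_⟩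
  rintro a a' μ ⟨ha, hGa⟩ ⟨ha', hGa'⟩ ⟨hμ, hGμ⟩ x ⟨hx1, hx0⟩
  have hβ : 0 < 1 + x := by linarith
  have hb0 : 0 < (1 + x) ^ α := Real.rpow_pos_of_pos hβ α
  have hb1 : (1 + x) ^ α < 1 := Real.rpow_lt_one hβ.le (by linarith) hα
  have hpow := powTwoPi_div_stableS hp hb1
  have hκ1 : 0 < (1 - (1 + x) ^ α) / (1 + x) ^ α := div_pos (by linarith) hb0
  have hκ2 : 0 < 4 * (1 - (1 + x) ^ α) / ((1 + x) ^ α) ^ 2 :=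
    div_pos (by linarith) (by positivity)
  have hinv1 : ∀ Y ∈ Complex.slitPlane, 1 + Y = ((((1 + x) ^ α)⁻¹ : ℝ) : ℂ) ↔
      Y = (((1 - (1 + x) ^ α) / (1 + x) ^ α : ℝ) : ℂ) := fun Y _ => one_add_eq_inv_iff hb0 Y
  have hinv2 : ∀ Y ∈ Complex.slitPlane, halfOneAddSqrt Y = ((((1 + x) ^ α)⁻¹ : ℝ) : ℂ) ↔
      Y = ((4 * (1 - (1 + x) ^ α) / ((1 + x) ^ α) ^ 2 : ℝ) : ℂ) :=
    fun Y hY => halfOneAddSqrt_eq_inv_iff hb0 hb1 hY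
  have r1 := rpow_one_sub_div_div hα hβ rfl hb1 hc
  have r2 := rpow_four_mul_one_sub_div_div hα hβ rfl hb1 hc
  have r3 := rpow_one_sub_div_div_four hα hβ rfl hb1 hc
  obtain ⟨hm, hSm⟩ := sTransform_marchenkoPastur hx1 hx0
  have hxc : (x : ℂ) ≠ 0 := by exact_mod_cast hx0.ne
  have hβc : (1 + x : ℂ) ≠ 0 := by exact_mod_cast hβ.ne'
  have hβc' : (x + 1 : ℂ) ≠ 0 := by rwa [add_comm]
  -- As `α > 0`, the two cases exclude each other, so `arg s` determines which `θ` was chosen.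
  have hexcl : ¬ (Real.pi = (1 - α / 2) * Real.pi) := by
    intro h0
    nlinarith
  refine ⟨hm, fun hs1 => ?_, fun hs2 => ?_⟩
  · have hθ : θ = Real.pi := by
      rcases hcases with h1 | h1
      · exact h1.2
      · exact absurd (hs1.symm.trans h1.1) hexcl
    subst hθ
    obtain ⟨m1, S1⟩ := sTransform_positive hp isSectorMap_one_add hGa hx1 hx0 hκ1 hinv1
    obtain ⟨m2, S2⟩ := sTransform_positive hp4 isSectorMap_one_add hGa' hx1 hx0 hκ1 hinv1
    obtain ⟨m3, S3⟩ := sTransform_positive hp isSectorMap_halfOneAddSqrt hGμ hx1 hx0 hκ2 hinv2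
    rw [sub_self, Complex.ofReal_zero, zero_mul, Complex.exp_zero, mul_one] at hpow
    rw [r1] at S1
    rw [r3] at S2
    rw [r2] at S3
    refine ⟨m1, m2, m3, ?_, ?_, ?_⟩
    · rw [S1, hpow]
      push_cast
      field_simp
    · rw [S3, hpow, add_comm (x : ℂ) 1]
      push_cast
      field_simp
    · rw [S3, S2, hSm]
      push_cast
      field_simp
  · have hθ : θ = Real.pi / 2 := by
      rcases hcases with h1 | h1
      · exact absurd (h1.1.symm.trans hs2) hexcl
      · exact h1.2
    subst hθ
    obtain ⟨⟨m1, S1⟩, ⟨n1, T1⟩⟩ :=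
      sTransform_symmetric hp isSectorMap_one_add hGa hx1 hκ1 hinv1
    obtain ⟨⟨m2, S2⟩, ⟨n2, T2⟩⟩ :=
      sTransform_symmetric hp4 isSectorMap_one_add hGa' hx1 hκ1 hinv1
    obtain ⟨⟨m3, S3⟩, ⟨n3, T3⟩⟩ :=
      sTransform_symmetric hp isSectorMap_halfOneAddSqrt hGμ hx1 hκ2 hinv2
    rw [show Real.pi - Real.pi / 2 = Real.pi / 2 by ring, Complex.ofReal_div, Complex.ofReal_ofNat,
      Complex.exp_pi_div_two_mul_I] at hpow
    rw [r1] at S1 T1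
    rw [r3] at S2 T2
    rw [r2] at S3 T3
    refine ⟨⟨m1, m2, m3, ?_, ?_, ?_⟩, n1, n2, n3, ?_, ?_, ?_⟩
    · rw [S1, hpow]
      push_cast
      field_simp
    · rw [S3, hpow, add_comm (x : ℂ) 1]
      push_cast
      field_simp
    · rw [S3, S2, hSm]
      push_cast
      field_simp
    · rw [T1, hpow]
      push_cast
      field_simp
    · rw [T3, hpow, add_comm (x : ℂ) 1]
      push_cast
      field_simp
    · rw [T3, T2, hSm]
      push_cast
      field_simp
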